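/- For a finite signed Borel measure $M$ on $\mathbb R^d$ let $M^{*j}$ denote its $j$-th convolution power, $M^{*0}=I$, where $I$ is the unit mass at $\vec 0\in\mathbb R^d$, and let $\exp\{M\}=\sum_{j\ge 0}M^{*j}/j!$. For two such measures put $d(M,V)=\sup_B|M\{B\}-V\{B\}|$, the supremum being over all Borel sets $B\subset\mathbb R^d$. There is an absolute constant $C>0$ such that the following holds. Let $d,K$ be natural numbers with $K\ge d$, and let $F$ be a probability distribution on $\mathbb R^d$ such that: 1. $F=qI+\sum_{m=1}^K p_mF_m$, where $q,p_1,\dots,p_K\in(0,1)$, $\sum_{m=1}^K p_m=1-q$, and $F_1,\dots,F_K$ are probability distributions on $\mathbb R^d$; 2. there are non-zero vectors $\vec y_1,\dots,\vec y_K\in\mathbb R^d$ such that $\operatorname{supp}F_m\subset\{k\vec y_m:k\in\mathbb Z\setminus\{0\}\}$ for all $m$, and $\operatorname{supp}F_m\cap\operatorname{supp}F_k=\emptyset$ for $k\ne m$; 3. all $\operatorname{supp}F_m$ are non-empty and all $F_m$ are symmetric: $F_m\{k\vec y_m\}=F_m\{-k\vec y_m\}$ for $k=1,2,\dots$ and $m=1,\dots,K$;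 4. for every $m$ there is an integer $k_m^0$ with $F_m\{k_m^0\vec y_m\}>0$ and $F_m\{(k_m^0+1)\vec y_m\}>0$. Suppose also that $\sigma_m^2:=\sum_{k\in\mathbb Z}k^2F_m\{k\vec y_m\}<\infty$, with $\sigma_m\ge 0$, for $m=1,\dots,K$. For real $a$ put $D^{*a}=\exp\{a(F-I)-\tfrac a2(F-I)^{*2}\}$. Then, for every integer $n\ge 1$, $$d(F^{*n},D^{*n})\le\frac{C}{n^2q^{13/2}}\Bigl(\sum_{m=1}^K\sqrt{1+\sigma_m}\Bigr)^3 .$$ -/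

import Mathlib

open MeasureTheory

namespace SignedCP

section Measures

variable {E : Type*} [MeasurableSpace E]

/-- A signed measure has finite total variation. -/
theorem isFiniteMeasure_variation (M : SignedMeasure E) : IsFiniteMeasure M.variation := by
  rw [← SignedMeasure.totalVariation_eq_variation]
  unfold SignedMeasure.totalVariation
  infer_instance

/-- The total variation distance `sup_B |M(B) - V(B)|`, the supremum being over all measurable
sets `B`. -/
noncomputable def tvDist (M V : SignedMeasure E) : ℝ :=
  ⨆ B : {B : Set E // MeasurableSet B}, |M B - V B|

/-- The supremum that defines `tvDist` is over a bounded set. -/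
theorem bddAbove_tvDist (M V : SignedMeasure E) :
    BddAbove (Set.range fun B : {B : Set E // MeasurableSet B} => |M B - V B|) := by
  refine ⟨(M - V).bound, ?_⟩
  rintro _ ⟨B, rfl⟩
  have h := VectorMeasure.norm_apply_le_bound (μ := M - V) (s := (B : Set E))
  simpa using h

variable [AddCommMonoid E]

/-- The measure `I`: the unit mass at the origin. -/
noncomputable def unitMass (E : Type*) [MeasurableSpace E] [AddCommMonoid E] : SignedMeasure E :=
  (Measure.dirac (0 : E)).toSignedMeasure

/-- The convolution `M * V` of two signed measures: the image of their product under addition. -/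
noncomputable def conv (M V : SignedMeasure E) : SignedMeasure E :=
  (M.prod V (ContinuousLinearMap.mul ℝ ℝ)).map fun z : E × E => z.1 + z.2

/-- The convolution power `M^{*j}`, with `M^{*0} = I`. -/
noncomputable def convPow (M : SignedMeasure E) : ℕ → SignedMeasure E
  | 0 => unitMass E
  | j + 1 => conv (convPow M j) M

theorem variation_conv_le (M V : SignedMeasure E) :
    (conv M V).variation Set.univ ≤ M.variation Set.univ * V.variation Set.univ := by
  have := isFiniteMeasure_variation M
  have := isFiniteMeasure_variation V
  by_cases hm : Measurable fun z : E × E => z.1 + z.2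
  · calc (conv M V).variation Set.univ
        ≤ ((M.prod V (ContinuousLinearMap.mul ℝ ℝ)).variation.map
            fun z : E × E => z.1 + z.2) Set.univ := VectorMeasure.variation_map_le _
      _ = (M.prod V (ContinuousLinearMap.mul ℝ ℝ)).variation Set.univ := by
          rw [Measure.map_apply hm MeasurableSet.univ, Set.preimage_univ]
      _ ≤ (‖ContinuousLinearMap.mul ℝ ℝ‖ₑ • M.variation.prod V.variation) Set.univ :=
          VectorMeasure.variation_prod_le _
      _ = M.variation Set.univ * V.variation Set.univ := by
          rw [← Set.univ_prod_univ, Measure.smul_apply, Measure.prod_prod]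
          simp [enorm_eq_nnnorm]
  · simp [conv, VectorMeasure.map, hm]

theorem variation_convPow_le (M : SignedMeasure E) (j : ℕ) :
    (convPow M j).variation Set.univ ≤ M.variation Set.univ ^ j := by
  induction j with
  | zero => simp [convPow, unitMass, Measure.variation_toSignedMeasure]
  | succ j ih =>
    rw [pow_succ]
    exact (variation_conv_le _ _).trans (by gcongr)

/-- Bound from which the convergence of the exponential series follows. -/
theorem sum_abs_convPow_le (M : SignedMeasure E) (j : ℕ) {f : ℕ → Set E}
    (hf : ∀ i, MeasurableSet (f i)) (hd : Pairwise (Function.onFun Disjoint f)) :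
    (Summable fun i => |convPow M j (f i)|) ∧
      ∑' i, |convPow M j (f i)| ≤ (M.variation Set.univ).toReal ^ j := by
  have := isFiniteMeasure_variation M
  have := isFiniteMeasure_variation (convPow M j)
  have hs : HasSum (fun i => (convPow M j).variation.real (f i))
      ((convPow M j).variation.real (⋃ i, f i)) := by
    have h := VectorMeasure.m_iUnion ((convPow M j).variation.toSignedMeasure) hf hd
    simpa [Measure.toSignedMeasure_apply_measurable, hf, MeasurableSet.iUnion hf] using h
  have hle : ∀ i, |convPow M j (f i)| ≤ (convPow M j).variation.real (f i) := fun i => by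
    rw [← Real.norm_eq_abs]
    exact VectorMeasure.norm_measure_le_variation (by finiteness)
  have hsum : Summable fun i => |convPow M j (f i)| :=
    Summable.of_nonneg_of_le (fun _ => abs_nonneg _) hle hs.summable
  refine ⟨hsum, ?_⟩
  calc ∑' i, |convPow M j (f i)| ≤ ∑' i, (convPow M j).variation.real (f i) :=
        hsum.tsum_le_tsum hle hs.summable
    _ = (convPow M j).variation.real (⋃ i, f i) := hs.tsum_eq
    _ ≤ (convPow M j).variation.real Set.univ := measureReal_mono (Set.subset_univ _)
    _ ≤ (M.variation Set.univ).toReal ^ j := by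
        rw [← ENNReal.toReal_pow]
        exact ENNReal.toReal_mono (by finiteness) (variation_convPow_le M j)

theorem summable_exp_series (M : SignedMeasure E) {f : ℕ → Set E}
    (hf : ∀ i, MeasurableSet (f i)) (hd : Pairwise (Function.onFun Disjoint f)) :
    Summable fun z : ℕ × ℕ => ((z.1.factorial : ℝ))⁻¹ * convPow M z.1 (f z.2) := by
  rw [← summable_abs_iff, summable_prod_of_nonneg (fun _ => abs_nonneg _)]
  simp only [abs_mul, abs_inv, Nat.abs_cast]
  refine ⟨fun j => (sum_abs_convPow_le M j hf hd).1.mul_left _, ?_⟩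
  refine Summable.of_nonneg_of_le (fun j => tsum_nonneg fun i => by positivity) (fun j => ?_)
    (Real.summable_pow_div_factorial (M.variation Set.univ).toReal)
  rw [tsum_mul_left, div_eq_inv_mul]
  exact mul_le_mul_of_nonneg_left (sum_abs_convPow_le M j hf hd).2 (by positivity)

/-- The exponential measure `exp{M} = ∑_{j ≥ 0} M^{*j} / j!` of a signed measure `M`. -/
noncomputable def expMeasure (M : SignedMeasure E) : SignedMeasure E where
  measureOf' A := ∑' j : ℕ, ((j.factorial : ℝ))⁻¹ * convPow M j A
  empty' := by simp
  not_measurable' A hA := by simp [VectorMeasure.not_measurable _ hA]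
  m_iUnion' f hf hd := by
    have h := summable_exp_series M hf hd
    have h' := (Equiv.prodComm ℕ ℕ).summable_iff.mpr h
    have hi := h'.hasSum.prod_fiberwise (fun i => (h'.prod_factor i).hasSum)
    have heq : ∑' z : ℕ × ℕ,
        ((fun z : ℕ × ℕ => ((z.1.factorial : ℝ))⁻¹ * convPow M z.1 (f z.2)) ∘
          (Equiv.prodComm ℕ ℕ)) z
        = ∑' j : ℕ, ((j.factorial : ℝ))⁻¹ * convPow M j (⋃ i, f i) := by
      refine ((Equiv.prodComm ℕ ℕ).tsum_eq
        (fun z : ℕ × ℕ => ((z.1.factorial : ℝ))⁻¹ * convPow M z.1 (f z.2))).trans ?_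
      rw [h.tsum_prod]
      refine tsum_congr fun j => ?_
      dsimp only
      rw [tsum_mul_left, (VectorMeasure.m_iUnion (convPow M j) hf hd).tsum_eq]
    rw [heq] at hi
    exact hi

/-- The exponential series converges on every set. -/
theorem hasSum_expMeasure (M : SignedMeasure E) {A : Set E} (hA : MeasurableSet A) :
    HasSum (fun j : ℕ => ((j.factorial : ℝ))⁻¹ * convPow M j A) (expMeasure M A) := by
  have hd : Pairwise (Function.onFun Disjoint fun i : ℕ => if i = 0 then A else ∅) := by
    intro i j hij
    by_cases hi : i = 0
    · have hj : j ≠ 0 := fun h => hij (hi.trans h.symm)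
      simp [Function.onFun, hj]
    · simp [Function.onFun, hi]
  have h := summable_exp_series M (f := fun i => if i = 0 then A else ∅)
    (fun i => by by_cases hi : i = 0 <;> simp [hi, hA]) hd
  have h2 := h.comp_injective (i := fun j : ℕ => (j, 0)) (fun a b hab => (Prod.ext_iff.mp hab).1)
  have h3 : Summable fun j : ℕ => ((j.factorial : ℝ))⁻¹ * convPow M j A := by
    simpa [Function.comp_def] using h2
  exact h3.hasSum

/-- The second-order signed compound Poisson measure of Hipp's type
`D^{*a} = exp{a (F - I) - (a / 2) (F - I)^{*2}}`; in particular `D = hippD F 1`. -/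
noncomputable def hippD (F : Measure E) [IsFiniteMeasure F] (a : ℝ) : SignedMeasure E :=
  expMeasure (a • (F.toSignedMeasure - unitMass E)
    - (a / 2) • convPow (F.toSignedMeasure - unitMass E) 2)

end Measures

/-- `F` is the mixture `q I + ∑ p_m F_m`, where the symmetric distribution `F_m = G m` is
concentrated on the non-zero integer multiples of the non-zero vector `y_m`, the supports of the
`F_m` are pairwise disjoint and non-empty, and `F_m` charges two consecutive multiples of `y_m`. -/
structure LinesAssumptions {d K : ℕ} (F : Measure (EuclideanSpace ℝ (Fin d))) (q : ℝ)
    (p : Fin K → ℝ) (G : Fin K → Measure (EuclideanSpace ℝ (Fin d)))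
    (y : Fin K → EuclideanSpace ℝ (Fin d)) : Prop where
  dim_le : d ≤ K
  q_mem : q ∈ Set.Ioo (0 : ℝ) 1
  p_mem : ∀ m, p m ∈ Set.Ioo (0 : ℝ) 1
  sum_p : ∑ m, p m = 1 - q
  isProbabilityMeasure : ∀ m, IsProbabilityMeasure (G m)
  mixture : F = ENNReal.ofReal q • Measure.dirac 0 + ∑ m, ENNReal.ofReal (p m) • G m
  y_ne_zero : ∀ m, y m ≠ 0
  support_subset : ∀ m, (G m).support ⊆ {x | ∃ k : ℤ, k ≠ 0 ∧ x = (k : ℝ) • y m}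
  support_disjoint : ∀ m l, m ≠ l → Disjoint (G m).support (G l).support
  support_nonempty : ∀ m, (G m).support.Nonempty
  symmetric : ∀ m, ∀ k : ℕ, 1 ≤ k → G m {(k : ℝ) • y m} = G m {-((k : ℝ) • y m)}
  consecutive : ∀ m, ∃ k : ℤ, 0 < G m {(k : ℝ) • y m} ∧ 0 < G m {((k : ℝ) + 1) • y m}

/-- The terms `k² F_m{k y_m}`, `k ∈ ℤ`, of the series for `σ_m²`. -/
noncomputable def secondMomentTerm {d : ℕ} (G : Measure (EuclideanSpace ℝ (Fin d)))
    (y : EuclideanSpace ℝ (Fin d)) (k : ℤ) : ℝ :=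
  (k : ℝ) ^ 2 * G.real {(k : ℝ) • y}

/-- The standard deviation `σ_m`, where `σ_m² = ∑_{k ∈ ℤ} k² F_m{k y_m}`. -/
noncomputable def sigma {d : ℕ} (G : Measure (EuclideanSpace ℝ (Fin d)))
    (y : EuclideanSpace ℝ (Fin d)) : ℝ :=
  √(∑' k : ℤ, secondMomentTerm G y k)

end SignedCP

/-! Convolution with a discrete signed measure is an operator on bounded functions, an absolutely
convergent combination of translations. Evaluating its action on an indicator at 0 gives the mass of
the set, so the distance is at most the operator norm of a difference, and the estimate takes place
in a commutative Banach algebra.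

There let `w` stand for `F - I` and `V = w - w² / 2`. The choice of `V` cancels the first two
orders, so `1 + w - exp V = w³ r` with `r` bounded (`exists_one_add_sub_exp_eq`). The geometric
identity then gives `(1 + w)^n - exp(n V) = w³ r ∑ (1 + w)^i exp(V)^(n - 1 - i)`. Each `w` should
gain a factor of order `1 / n`. With `c = q n / 6`, three copies of `exp(c w)` are attached to `w³`,
and `exp(-(q n / 2) w)` is attached to the sum in compensation. Two norm bounds remain.

Smoothing: `w exp(c w)` splits over the directions `m`, and the compound Poisson factors of the
other directions are contractions. For one direction the norm of `(X - 1) exp(l (X - 1))` is at most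
`9 √(1 + σ) / l` (`IsSymmetricLaw.norm_sub_one_mul_exp_le`). With `l = c p_m` the weight `p_m`
cancels, which gives `∑ √(1 + σ_m)` over `q n`, cubed in the end.

Stability: each summand with its share of `exp(-(q n / 2) w)` is bounded by a multiple of `1 / √q`
(`norm_binomial_mul_exp_le`). The modulus of the symbols of `1 + w` and `exp V` decays at rate at
least `q (1 - q) (1 - cos t)` per factor, and the inserted growth uses half of that rate.

Both bounds rest on one principle (`SameSeries.sq_norm_le`): a combination of contractions `v i`
that multiply like characters has norm at most the `ℓ¹` norm of its coefficients. These are the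
Fourier coefficients of a scalar symbol, and a weighted Cauchy-Schwarz inequality with Parseval
bounds their sum by the mean squares of the symbol and its derivative. In total the power of `q` is
`7 / 2`, which is stronger than `13 / 2`. -/

namespace SignedCP

/-! ### Absolutely convergent series over an additive monoid, in a Banach algebra. -/

section AbsolutelyConvergent

/-- A homomorphism from an additive monoid to the unit ball of a normed ring. -/
structure IsContractiveHom {ι B : Type*} [AddCommMonoid ι] [NormedRing B] (v : ι → B) : Prop where
  map_zero : v 0 = 1
  map_add : ∀ i j, v (i + j) = v i * v j
  norm_le : ∀ i, ‖v i‖ ≤ 1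

/-- The convolution of two families of coefficients on an additive monoid. -/
noncomputable def coeffMul {ι : Type*} [AddCommMonoid ι] (a b : ι → ℝ) (k : ι) : ℝ :=
  ∑' z : ((fun z : ι × ι => z.1 + z.2) ⁻¹' {k}), a z.1.1 * b z.1.2

/-- Convolution powers of a family of coefficients. -/
noncomputable def coeffPow {ι : Type*} [AddCommMonoid ι] (a : ι → ℝ) : ℕ → ι → ℝ
  | 0 => Set.indicator {0} 1
  | j + 1 => coeffMul (coeffPow a j) a

/-- The coefficients of the exponential of a series. -/
noncomputable def coeffExp {ι : Type*} [AddCommMonoid ι] (a : ι → ℝ) (k : ι) : ℝ :=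
  ∑' j : ℕ, ((j.factorial : ℝ))⁻¹ * coeffPow a j k

variable {ι B : Type*} [NormedRing B] [NormedAlgebra ℝ B] {v : ι → B} {a b : ι → ℝ} {X Y : B}

theorem summable_abs_mul (ha : Summable a) (hb : Summable b) :
    Summable fun z : ι × ι => |a z.1 * b z.2| := by
  simpa [abs_mul] using ha.abs.mul_of_nonneg hb.abs (fun _ => abs_nonneg _) (fun _ => abs_nonneg _)

/-- `X = ∑ c_i v_i` and `h = ∑ c_i χ_i` with the same absolutely summable coefficients `c`. -/
def SameSeries {ι A : Type*} [NormedRing A] [NormedAlgebra ℝ A] (v : ι → A) (χ : ι → ℝ → ℂ)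
    (X : A) (h : ℝ → ℂ) : Prop :=
  ∃ c : ι → ℝ, Summable c ∧ HasSum (fun i => c i • v i) X ∧
    ∀ t, HasSum (fun i => c i • χ i t) (h t)

namespace SameSeries

variable {χ : ι → ℝ → ℂ} {h g : ℝ → ℂ}

theorem basis (v : ι → B) (χ : ι → ℝ → ℂ) (i : ι) : SameSeries v χ (v i) (χ i) := by
  classical
  refine ⟨Pi.single i 1, ?_, ?_, fun t => ?_⟩
  · exact (hasSum_pi_single i (1 : ℝ)).summable
  · simpa using hasSum_single (f := fun j => (Pi.single i 1 : ι → ℝ) j • v j) i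
      (fun j hj => by simp [hj])
  · simpa using hasSum_single (f := fun j => (Pi.single i 1 : ι → ℝ) j • χ j t) i
      (fun j hj => by simp [hj])

theorem add (hX : SameSeries v χ X h) (hY : SameSeries v χ Y g) :
    SameSeries v χ (X + Y) (h + g) := by
  obtain ⟨c, hc, h1, h2⟩ := hX
  obtain ⟨c', hc', h1', h2'⟩ := hY
  exact ⟨c + c', hc.add hc', by simpa [add_smul] using h1.add h1',
    fun t => by simpa [add_smul] using (h2 t).add (h2' t)⟩

theorem smul (r : ℝ) (hX : SameSeries v χ X h) : SameSeries v χ (r • X) (r • h) := by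
  obtain ⟨c, hc, h1, h2⟩ := hX
  exact ⟨r • c, hc.const_smul r, by simpa [mul_smul] using h1.const_smul r,
    fun t => by simpa [mul_smul, mul_assoc] using (h2 t).const_smul r⟩

theorem sub (hX : SameSeries v χ X h) (hY : SameSeries v χ Y g) :
    SameSeries v χ (X - Y) (h - g) := by
  simpa [sub_eq_add_neg] using hX.add (hY.smul (-1))

end SameSeries

variable [AddCommMonoid ι]

theorem IsContractiveHom.norm_smul_le (hv : IsContractiveHom v) (a : ι → ℝ) (i : ι) :
    ‖a i • v i‖ ≤ |a i| := by
  rw [norm_smul, Real.norm_eq_abs]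
  exact mul_le_of_le_one_right (abs_nonneg _) (hv.norm_le i)

theorem IsContractiveHom.summable_norm_smul (hv : IsContractiveHom v) (ha : Summable a) :
    Summable fun i => ‖a i • v i‖ :=
  Summable.of_nonneg_of_le (fun _ => norm_nonneg _) (hv.norm_smul_le a) ha.abs

theorem IsContractiveHom.norm_le_tsum (hv : IsContractiveHom v) (ha : Summable a)
    (hX : HasSum (fun i => a i • v i) X) : ‖X‖ ≤ ∑' i, |a i| := by
  rw [← hX.tsum_eq]
  exact (norm_tsum_le_tsum_norm (hv.summable_norm_smul ha)).trans
    ((hv.summable_norm_smul ha).tsum_le_tsum (hv.norm_smul_le a) ha.abs)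

theorem hasSum_abs_fiber (ha : Summable a) (hb : Summable b) :
    HasSum (fun k => ∑' z : ((fun z : ι × ι => z.1 + z.2) ⁻¹' {k}), |a z.1.1 * b z.1.2|)
      ((∑' i, |a i|) * ∑' i, |b i|) := by
  have h := (summable_abs_mul ha hb).hasSum.tsum_fiberwise (fun z : ι × ι => z.1 + z.2)
  have e : ∑' z : ι × ι, |a z.1 * b z.2| = (∑' i, |a i|) * ∑' i, |b i| := by
    simp only [abs_mul]
    exact (ha.abs.tsum_mul_tsum hb.abs
      (by simpa only [abs_mul] using summable_abs_mul ha hb)).symm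
  rwa [e] at h

theorem abs_coeffMul_le (ha : Summable a) (hb : Summable b) (k : ι) :
    |coeffMul a b k| ≤ ∑' z : ((fun z : ι × ι => z.1 + z.2) ⁻¹' {k}), |a z.1.1 * b z.1.2| := by
  have h : Summable fun z : ((fun z : ι × ι => z.1 + z.2) ⁻¹' {k}) => ‖a z.1.1 * b z.1.2‖ :=
    (summable_abs_mul ha hb).subtype _
  simpa [coeffMul] using norm_tsum_le_tsum_norm h

theorem summable_coeffMul (ha : Summable a) (hb : Summable b) : Summable (coeffMul a b) := by
  rw [← summable_abs_iff]
  exact Summable.of_nonneg_of_le (fun _ => abs_nonneg _) (abs_coeffMul_le ha hb)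
    (hasSum_abs_fiber ha hb).summable

theorem tsum_abs_coeffMul_le (ha : Summable a) (hb : Summable b) :
    ∑' k, |coeffMul a b k| ≤ (∑' i, |a i|) * ∑' i, |b i| := by
  rw [← (hasSum_abs_fiber ha hb).tsum_eq]
  exact (summable_coeffMul ha hb).abs.tsum_le_tsum (abs_coeffMul_le ha hb)
    (hasSum_abs_fiber ha hb).summable

/-- The absolutely convergent double series is regrouped along the fibres of addition; on the fibre
over `k` every product `v i * v j` equals `v k`. -/
theorem IsContractiveHom.hasSum_coeffMul [CompleteSpace B] (hv : IsContractiveHom v)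
    (ha : Summable a) (hb : Summable b) (hX : HasSum (fun i => a i • v i) X) (hY : HasSum (fun i => b i • v i) Y) :
    HasSum (fun k => coeffMul a b k • v k) (X * Y) := by
  have hF : Summable fun z : ι × ι => (a z.1 • v z.1) * (b z.2 • v z.2) :=
    summable_mul_of_summable_norm (f := fun i => a i • v i) (g := fun i => b i • v i)
      (hv.summable_norm_smul ha) (hv.summable_norm_smul hb)
  have h1 : HasSum (fun z : ι × ι => (a z.1 • v z.1) * (b z.2 • v z.2)) (X * Y) :=
    HasSum.mul (f := fun i => a i • v i) (g := fun i => b i • v i) hX hY hF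
  have h2 := h1.tsum_fiberwise (fun z : ι × ι => z.1 + z.2)
  have h3 : ∀ k, ∑' z : ((fun z : ι × ι => z.1 + z.2) ⁻¹' {k}),
      (a z.1.1 • v z.1.1) * (b z.1.2 • v z.1.2) = coeffMul a b k • v k := by
    intro k
    have hs : Summable fun z : ((fun z : ι × ι => z.1 + z.2) ⁻¹' {k}) => a z.1.1 * b z.1.2 :=
      (summable_abs_mul ha hb).of_abs.subtype _
    rw [coeffMul, ← hs.tsum_smul_const]
    refine tsum_congr fun z => ?_
    have hz : z.1.1 + z.1.2 = k := z.2
    rw [smul_mul_smul_comm, ← hv.map_add, hz]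
  simpa only [h3] using h2

theorem summable_coeffPow (ha : Summable a) (j : ℕ) : Summable (coeffPow a j) := by
  induction j with
  | zero => exact summable_of_hasFiniteSupport ((Set.finite_singleton (0 : ι)).subset
      Set.support_indicator_subset)
  | succ j ih => exact summable_coeffMul ih ha

theorem tsum_abs_coeffPow_le (ha : Summable a) (j : ℕ) :
    ∑' k, |coeffPow a j k| ≤ (∑' k, |a k|) ^ j := by
  induction j with
  | zero =>
    rw [tsum_eq_single 0 (fun i hi => by simp [coeffPow, hi])]
    simp [coeffPow]
  | succ j ih =>
    rw [pow_succ]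
    refine (tsum_abs_coeffMul_le (summable_coeffPow ha j) ha).trans ?_
    gcongr

theorem IsContractiveHom.hasSum_coeffPow [CompleteSpace B] (hv : IsContractiveHom v)
    (ha : Summable a) (hX : HasSum (fun i => a i • v i) X) (j : ℕ) :
    HasSum (fun k => coeffPow a j k • v k) (X ^ j) := by
  induction j with
  | zero =>
    have := hasSum_single (f := fun k => coeffPow a 0 k • v k) 0
      (fun i hi => by simp [coeffPow, hi])
    simpa [coeffPow, hv.map_zero] using this
  | succ j ih =>
    rw [pow_succ]
    exact hv.hasSum_coeffMul (summable_coeffPow ha j) ha ih hX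

theorem summable_coeffExp_terms (ha : Summable a) :
    Summable fun z : ℕ × ι => |((z.1.factorial : ℝ))⁻¹ * coeffPow a z.1 z.2| := by
  rw [summable_prod_of_nonneg (fun _ => abs_nonneg _)]
  simp only [abs_mul, abs_inv, Nat.abs_cast]
  refine ⟨fun j => (summable_coeffPow ha j).abs.mul_left _, ?_⟩
  refine Summable.of_nonneg_of_le (fun j => tsum_nonneg fun i => by positivity) (fun j => ?_)
    (Real.summable_pow_div_factorial (∑' k, |a k|))
  rw [tsum_mul_left, div_eq_inv_mul]
  exact mul_le_mul_of_nonneg_left (tsum_abs_coeffPow_le ha j) (by positivity)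

theorem summable_coeffExp (ha : Summable a) : Summable (coeffExp a) := by
  have h := (Equiv.prodComm ι ℕ).summable_iff.mpr (summable_coeffExp_terms ha).of_abs
  exact h.prod

theorem hasSum_exp [CompleteSpace B] (X : B) :
    HasSum (fun j : ℕ => ((j.factorial : ℝ))⁻¹ • X ^ j) (NormedSpace.exp X) :=
  NormedSpace.exp_series_hasSum_exp' (𝕂 := ℝ) X

/-- The double series over the exponent `j` and the index `k` converges absolutely. Summing over `k`
first produces the exponential series, summing over `j` first produces the coefficients. -/
theorem IsContractiveHom.hasSum_coeffExp [CompleteSpace B] (hv : IsContractiveHom v)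
    (ha : Summable a) (hX : HasSum (fun i => a i • v i) X) :
    HasSum (fun k => coeffExp a k • v k) (NormedSpace.exp X) := by
  have hs : Summable fun z : ℕ × ι =>
      (((z.1.factorial : ℝ))⁻¹ * coeffPow a z.1 z.2) • v z.2 := by
    refine Summable.of_norm_bounded (summable_coeffExp_terms ha) fun z => ?_
    rw [norm_smul, Real.norm_eq_abs]
    exact mul_le_of_le_one_right (abs_nonneg _) (hv.norm_le _)
  have h1 := hs.hasSum.prod_fiberwise (g := fun j : ℕ => ((j.factorial : ℝ))⁻¹ • X ^ j) (fun j => by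
    simpa only [mul_smul] using (hv.hasSum_coeffPow ha hX j).const_smul ((j.factorial : ℝ))⁻¹)
  have e : ∑' z : ℕ × ι, (((z.1.factorial : ℝ))⁻¹ * coeffPow a z.1 z.2) • v z.2
      = NormedSpace.exp X := h1.unique (hasSum_exp X)
  have h2 := (Equiv.prodComm ι ℕ).hasSum_iff.mpr hs.hasSum
  rw [e] at h2
  refine h2.prod_fiberwise fun k => ?_
  have hk : Summable fun j : ℕ => ((j.factorial : ℝ))⁻¹ * coeffPow a j k :=
    ((Equiv.prodComm ι ℕ).summable_iff.mpr (summable_coeffExp_terms ha).of_abs).prod_factor k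
  exact hk.hasSum.smul_const (v k)

namespace SameSeries

variable {χ : ι → ℝ → ℂ} {h g : ℝ → ℂ}

/-- The coefficients of a product depend only on the index monoid, so one family serves both the
algebra and every character. This is what transports algebraic expressions to scalar symbols. -/
theorem mul [CompleteSpace B] (hv : IsContractiveHom v) (hχ : ∀ t, IsContractiveHom fun i => χ i t)
    (hX : SameSeries v χ X h) (hY : SameSeries v χ Y g) : SameSeries v χ (X * Y) (h * g) := by
  obtain ⟨c, hc, h1, h2⟩ := hX
  obtain ⟨c', hc', h1', h2'⟩ := hY
  exact ⟨coeffMul c c', summable_coeffMul hc hc', hv.hasSum_coeffMul hc hc' h1 h1',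
    fun t => (hχ t).hasSum_coeffMul hc hc' (h2 t) (h2' t)⟩

theorem one (hv : IsContractiveHom v) (hχ : ∀ t, IsContractiveHom fun i => χ i t) :
    SameSeries v χ (1 : B) 1 := by
  have h := basis v χ 0
  rwa [hv.map_zero, show χ 0 = 1 from funext fun t => (hχ t).map_zero] at h

theorem pow [CompleteSpace B] (hv : IsContractiveHom v) (hχ : ∀ t, IsContractiveHom fun i => χ i t)
    (hX : SameSeries v χ X h) (j : ℕ) : SameSeries v χ (X ^ j) (h ^ j) := by
  induction j with
  | zero => simpa using one hv hχ
  | succ j ih => simpa [pow_succ] using ih.mul hv hχ hX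

theorem exp [CompleteSpace B] (hv : IsContractiveHom v) (hχ : ∀ t, IsContractiveHom fun i => χ i t)
    (hX : SameSeries v χ X h) :
    SameSeries v χ (NormedSpace.exp X) (fun t => Complex.exp (h t)) := by
  obtain ⟨c, hc, h1, h2⟩ := hX
  refine ⟨coeffExp c, summable_coeffExp hc, hv.hasSum_coeffExp hc h1, fun t => ?_⟩
  rw [Complex.exp_eq_exp_ℂ]
  exact (hχ t).hasSum_coeffExp hc (h2 t)

end SameSeries

end AbsolutelyConvergent

end SignedCP

namespace SignedCP

/-! ### Fourier coefficients on `[-π, π]` and the transfer of bounds from symbols to norms. -/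

section Fourier

open Real

theorem neg_pi_lt_pi : -π < π := by linarith [pi_pos]

/-- The Fourier coefficients of a function on `[-π, π]`. -/
noncomputable def coeff (H : ℝ → ℂ) (n : ℤ) : ℂ := fourierCoeffOn neg_pi_lt_pi H n

/-- The mean value of a function over `[-π, π]`. -/
noncomputable def circleMean (f : ℝ → ℝ) : ℝ := (2 * π)⁻¹ * ∫ t in (-π)..π, f t

/-- The character `t ↦ e^{ikt}` of the circle. -/
noncomputable def chi (k : ℤ) (t : ℝ) : ℂ := Complex.exp (k * t * Complex.I)

theorem chi_zero (t : ℝ) : chi 0 t = 1 := by simp [chi]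

theorem chi_add (k l : ℤ) (t : ℝ) : chi (k + l) t = chi k t * chi l t := by
  rw [chi, chi, chi, ← Complex.exp_add]
  push_cast
  ring_nf

theorem norm_chi (k : ℤ) (t : ℝ) : ‖chi k t‖ = 1 := by
  rw [chi, show ((k : ℂ) * t * Complex.I) = ((k * t : ℝ) : ℂ) * Complex.I by push_cast; ring,
    Complex.norm_exp_ofReal_mul_I]

@[fun_prop]
theorem continuous_chi (k : ℤ) : Continuous (chi k) := by
  unfold chi
  fun_prop

theorem chi_neg_pi (k : ℤ) : chi k (-π) = chi k π := by
  rw [chi, chi, Complex.exp_eq_exp_iff_exists_int]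
  exact ⟨-k, by push_cast; ring⟩

theorem hasDerivAt_chi (k : ℤ) (t : ℝ) : HasDerivAt (chi k) (k * Complex.I * chi k t) t := by
  have h : HasDerivAt (fun t : ℝ => (k : ℂ) * t * Complex.I) (k * Complex.I) t := by
    simpa using ((hasDerivAt_id t).ofReal_comp.const_mul (k : ℂ)).mul_const Complex.I
  have h2 := h.cexp
  rw [mul_comm] at h2
  exact h2

theorem isContractiveHom_chi {ι : Type*} [AddCommMonoid ι] (e : ι →+ ℤ) (t : ℝ) :
    IsContractiveHom fun i => chi (e i) t where
  map_zero := by simp [chi_zero]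
  map_add i j := by simp [chi_add]
  norm_le i := (norm_chi _ _).le

theorem coeff_eq_integral (H : ℝ → ℂ) (n : ℤ) :
    coeff H n = ((2 * π)⁻¹ : ℝ) • ∫ t in (-π)..π, chi (-n) t * H t := by
  have hpi : (π : ℂ) ≠ 0 := by exact_mod_cast pi_ne_zero
  rw [coeff, fourierCoeffOn_eq_integral, one_div, show π - -π = 2 * π by ring]
  congr 1
  refine intervalIntegral.integral_congr fun t _ => ?_
  simp only [smul_eq_mul, fourier_coe_apply, chi]
  congr 2
  push_cast
  field_simp

theorem integral_chi (k : ℤ) : ∫ t in (-π)..π, chi k t = if k = 0 then 2 * π else 0 := by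
  split_ifs with h
  · subst h
    simp only [chi_zero]
    simp
    ring
  · have hk : (k : ℂ) * Complex.I ≠ 0 := by simp [h]
    have h1 := integral_exp_mul_complex (a := -π) (b := π) hk
    have h2 : ∀ t : ℝ, chi k t = Complex.exp (k * Complex.I * t) := fun t => by
      rw [chi]; ring_nf
    simp only [h2, h1]
    rw [← h2, ← h2, chi_neg_pi, sub_self, zero_div, Complex.ofReal_zero]

theorem coeff_chi_mul (H : ℝ → ℂ) (θ k : ℤ) :
    coeff (fun t => chi (-θ) t * H t) k = coeff H (k + θ) := by
  rw [coeff_eq_integral, coeff_eq_integral]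
  congr 1
  refine intervalIntegral.integral_congr fun t _ => ?_
  simp only [← mul_assoc, ← chi_add]
  congr 2
  ring

/-- Orthogonality of characters, integrated termwise. Injectivity of `e` keeps distinct indices at
distinct frequencies, so the symbol determines the coefficients. -/
theorem coeff_eq_of_hasSum {ι : Type*} {e : ι → ℤ} (he : Function.Injective e) {c : ι → ℝ}
    (hc : Summable c) {h : ℝ → ℂ} (hh : ∀ t, HasSum (fun i => c i • chi (e i) t) (h t)) (i : ι) :
    coeff h (e i) = c i := by
  classical
  have : Countable ι := he.countable
  have hpi : (π : ℂ) ≠ 0 := by exact_mod_cast pi_ne_zero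
  have h1 : HasSum (fun j => ∫ t in (-π)..π, chi (-(e i)) t * (c j • chi (e j) t))
      (∫ t in (-π)..π, chi (-(e i)) t * h t) := by
    refine intervalIntegral.hasSum_integral_of_dominated_convergence (fun j _ => |c j|)
      (fun j => ?_) (fun j => ?_) ?_ ?_ ?_
    · exact (by fun_prop : Continuous fun t =>
        chi (-(e i)) t * (c j • chi (e j) t)).aestronglyMeasurable
    · exact Filter.Eventually.of_forall fun t _ => by
        simp [norm_chi]
    · exact Filter.Eventually.of_forall fun t _ => hc.abs
    · simp
    · exact Filter.Eventually.of_forall fun t _ => (hh t).mul_left _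
  have h2 : ∀ j, ∫ t in (-π)..π, chi (-(e i)) t * (c j • chi (e j) t)
      = if j = i then (c i * (2 * π) : ℂ) else 0 := by
    intro j
    have h3 : ∀ t, chi (-(e i)) t * (c j • chi (e j) t) = c j • chi (e j - e i) t := fun t => by
      rw [mul_smul_comm, ← chi_add]
      congr 2
      ring
    simp only [h3]
    rw [intervalIntegral.integral_smul, integral_chi]
    by_cases hj : j = i
    · subst hj
      simp
    · have : e j - e i ≠ 0 := sub_ne_zero.mpr fun h => hj (he h)
      simp [hj, this]
  simp only [h2] at h1
  rw [coeff_eq_integral, ← (hasSum_ite_eq i _).unique h1, Complex.real_smul]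
  push_cast
  field_simp

theorem hasSum_sq_coeff {H : ℝ → ℂ} (hH : Continuous H) :
    HasSum (fun k => ‖coeff H k‖ ^ 2) (circleMean fun t => ‖H t‖ ^ 2) := by
  have h : MemLp H 2 (volume.restrict (Set.Ioc (-π) π)) := by
    have : IsFiniteMeasure (volume.restrict (Set.Ioc (-π) π)) := inferInstance
    obtain ⟨C, hC⟩ := (isCompact_Icc (a := -π) (b := π)).exists_bound_of_continuousOn
      hH.continuousOn
    refine MemLp.of_bound hH.aestronglyMeasurable C ?_
    rw [ae_restrict_iff' measurableSet_Ioc]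
    exact Filter.Eventually.of_forall fun t ht => hC t ⟨ht.1.le, ht.2⟩
  have := hasSum_sq_fourierCoeffOn neg_pi_lt_pi h
  rwa [show π - -π = 2 * π by ring] at this

/-- Integration by parts; the boundary term vanishes because the endpoint values agree. -/
theorem abs_mul_norm_coeff_le {H H' : ℝ → ℂ} (hd : ∀ t, HasDerivAt H (H' t) t)
    (hc : Continuous H') (hp : H (-π) = H π) (k : ℤ) :
    |(k : ℝ)| * ‖coeff H k‖ ≤ ‖coeff H' k‖ := by
  rcases eq_or_ne k 0 with rfl | hk
  · simp
  have h := fourierCoeffOn_of_hasDerivAt neg_pi_lt_pi hk (fun t _ => hd t)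
    (hc.intervalIntegrable _ _)
  have hk' : (0 : ℝ) < |(k : ℝ)| := by positivity
  have hpi := pi_pos
  rw [hp, sub_self, mul_zero, zero_sub] at h
  rw [coeff, h, coeff]
  rw [norm_mul, norm_neg, norm_mul, norm_div]
  have e1 : ‖(-2 * π * Complex.I * k : ℂ)‖ = 2 * π * |(k : ℝ)| := by
    simp [abs_of_pos hpi]
  have e2 : ‖((π : ℂ) - ((-π : ℝ) : ℂ))‖ = 2 * π := by
    rw [← Complex.ofReal_sub, Complex.norm_real, Real.norm_eq_abs, abs_of_pos (by linarith)]
    ring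
  rw [e1, e2, norm_one]
  apply le_of_eq
  field_simp

/-- Since `2 (b² + (n + 1)²) ≥ (b + n + 1)²`, the terms on each half-line are dominated by a
telescoping series with total `2 b`; the central term adds 1. -/
theorem hasSum_cauchyWeight {b : ℝ} (hb : 0 < b) :
    ∃ S ≤ 1 + 4 * b, HasSum (fun k : ℤ => (1 + (k : ℝ) ^ 2 / b ^ 2)⁻¹) S := by
  set f : ℕ → ℝ := fun n => (1 + ((n : ℝ) + 1) ^ 2 / b ^ 2)⁻¹ with hf
  have hf0 : ∀ n, 0 ≤ f n := fun n => by positivity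
  have hle : ∀ n, f n ≤ 2 * b ^ 2 * ((b + n)⁻¹ - (b + n + 1)⁻¹) := by
    intro n
    have h1 : 0 < b + n := by positivity
    have e1 : f n = b ^ 2 * (b ^ 2 + ((n : ℝ) + 1) ^ 2)⁻¹ := by
      simp only [hf]; field_simp
    have e2 : 2 * b ^ 2 * ((b + n)⁻¹ - (b + n + 1)⁻¹)
        = b ^ 2 * (((b + n) * (b + n + 1)) / 2)⁻¹ := by field_simp; ring
    rw [e1, e2]
    gcongr
    nlinarith [sq_nonneg (b - (n + 1))]
  have hsum : ∀ N, ∑ n ∈ Finset.range N, f n ≤ 2 * b := by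
    intro N
    have h1 : ∑ n ∈ Finset.range N, f n ≤ 2 * b ^ 2 * (b⁻¹ - (b + N)⁻¹) := by
      induction N with
      | zero => simp
      | succ N ih =>
        rw [Finset.sum_range_succ]
        push_cast
        have := hle N
        rw [← add_assoc]
        linarith
    have h2 : 0 ≤ 2 * b ^ 2 * (b + N)⁻¹ := by positivity
    have h3 : 2 * b ^ 2 * b⁻¹ = 2 * b := by field_simp
    linarith
  have hs : Summable f := summable_of_sum_range_le hf0 hsum
  have ht : ∑' n, f n ≤ 2 * b := hs.tsum_le_of_sum_range_le hsum
  have h1 : HasSum (fun n : ℕ => (1 + (((n : ℤ) : ℝ)) ^ 2 / b ^ 2)⁻¹) (1 + ∑' n, f n) := by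
    have := (hasSum_nat_add_iff' (f := fun n : ℕ => (1 + (((n : ℤ) : ℝ)) ^ 2 / b ^ 2)⁻¹)
      (g := 1 + ∑' n, f n) 1).mp
    refine this ?_
    simpa [hf] using hs.hasSum
  have h2 : HasSum (fun n : ℕ => (1 + (((-((n : ℤ) + 1) : ℤ)) : ℝ) ^ 2 / b ^ 2)⁻¹)
      (∑' n, f n) := by
    have : ∀ n : ℕ, (1 + (((-((n : ℤ) + 1) : ℤ)) : ℝ) ^ 2 / b ^ 2)⁻¹ = f n := fun n => by
      simp only [hf]; push_cast; ring
    simpa only [this] using hs.hasSum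
  exact ⟨_, by linarith,
    HasSum.of_nat_of_neg_add_one (f := fun k : ℤ => (1 + (k : ℝ) ^ 2 / b ^ 2)⁻¹) h1 h2⟩

/-- A Bernstein type bound for the absolute sum of the Fourier coefficients. -/
theorem summable_coeff_and_sq_tsum_le {H H' : ℝ → ℂ} (hd : ∀ t, HasDerivAt H (H' t) t)
    (hc : Continuous H') (hp : H (-π) = H π) {b : ℝ} (hb : 0 < b) :
    Summable (fun k => ‖coeff H k‖) ∧ (∑' k, ‖coeff H k‖) ^ 2 ≤
      (1 + 4 * b) * ((circleMean fun t => ‖H t‖ ^ 2) +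
        (b ^ 2)⁻¹ * circleMean fun t => ‖H' t‖ ^ 2) := by
  have hH : Continuous H := continuous_iff_continuousAt.mpr fun t => (hd t).continuousAt
  obtain ⟨S, hS, hw⟩ := hasSum_cauchyWeight hb
  set R := (circleMean fun t => ‖H t‖ ^ 2) + (b ^ 2)⁻¹ * circleMean fun t => ‖H' t‖ ^ 2
  have hR := (hasSum_sq_coeff hH).add ((hasSum_sq_coeff hc).mul_left (b ^ 2)⁻¹)
  have hR0 : 0 ≤ R := hR.nonneg fun k => by positivity
  have key : ∀ s : Finset ℤ, (∑ k ∈ s, ‖coeff H k‖) ^ 2 ≤ (1 + 4 * b) * R := by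
    intro s
    rcases s.eq_empty_or_nonempty with rfl | hs
    · simp; positivity
    -- Cauchy-Schwarz with weights `1 + k² / b²`: the weighted squares are controlled by Parseval
    -- for `H` and `H'`, the inverse weights by `1 + 4 b`.
    have h1 := Finset.sq_sum_div_le_sum_sq_div s (fun k => ‖coeff H k‖)
      (g := fun k : ℤ => (1 + (k : ℝ) ^ 2 / b ^ 2)⁻¹) (fun k _ => by positivity)
    have h2 : ∑ k ∈ s, (1 + (k : ℝ) ^ 2 / b ^ 2)⁻¹ ≤ 1 + 4 * b :=
      (sum_le_hasSum s (fun k _ => by positivity) hw).trans hS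
    have h3 : ∑ k ∈ s, ‖coeff H k‖ ^ 2 / (1 + (k : ℝ) ^ 2 / b ^ 2)⁻¹ ≤ R := by
      refine le_trans (Finset.sum_le_sum fun k _ => ?_)
        (sum_le_hasSum s (fun k _ => by positivity) hR)
      have h4 := abs_mul_norm_coeff_le hd hc hp k
      have h5 : (k : ℝ) ^ 2 * ‖coeff H k‖ ^ 2 ≤ ‖coeff H' k‖ ^ 2 := by
        rw [← sq_abs (k : ℝ), ← mul_pow]
        gcongr
      calc ‖coeff H k‖ ^ 2 / (1 + (k : ℝ) ^ 2 / b ^ 2)⁻¹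
          = ‖coeff H k‖ ^ 2 + (b ^ 2)⁻¹ * ((k : ℝ) ^ 2 * ‖coeff H k‖ ^ 2) := by
            field_simp
        _ ≤ _ := by gcongr
    have h6 : 0 < ∑ k ∈ s, (1 + (k : ℝ) ^ 2 / b ^ 2)⁻¹ :=
      Finset.sum_pos (fun k _ => by positivity) hs
    rw [div_le_iff₀ h6] at h1
    calc _ ≤ _ := h1
      _ ≤ R * (1 + 4 * b) := by gcongr
      _ = _ := mul_comm _ _
  have key2 : ∀ s : Finset ℤ, ∑ k ∈ s, ‖coeff H k‖ ≤ √((1 + 4 * b) * R) := fun s =>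
    Real.le_sqrt_of_sq_le (key s)
  have hsum := summable_of_sum_le (fun k => norm_nonneg (coeff H k)) key2
  refine ⟨hsum, ?_⟩
  have h7 := hsum.tsum_le_of_sum_le key2
  calc _ ≤ (√((1 + 4 * b) * R)) ^ 2 := by
        gcongr
    _ = _ := Real.sq_sqrt (by positivity)

/-- Transfer of the bound on Fourier coefficients to a normed algebra: the frequency `θ` is removed
before the derivative is measured. -/
theorem SameSeries.sq_norm_le {ι A : Type*} [AddCommMonoid ι] [NormedRing A] [NormedAlgebra ℝ A]
    {v : ι → A} (hv : IsContractiveHom v) {e : ι → ℤ} (he : Function.Injective e) {X : A}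
    {H H' : ℝ → ℂ} (hX : SameSeries v (fun i => chi (e i)) X H)
    (hd : ∀ t, HasDerivAt H (H' t) t) (hc : Continuous H') {b : ℝ} (hb : 0 < b) (θ : ℤ) :
    ‖X‖ ^ 2 ≤ (1 + 4 * b) * ((circleMean fun t => ‖H t‖ ^ 2) +
        (b ^ 2)⁻¹ * circleMean fun t => ‖H' t - θ * Complex.I * H t‖ ^ 2) := by
  obtain ⟨c, hcs, h1, h2⟩ := hX
  have hH : Continuous H := continuous_iff_continuousAt.mpr fun t => (hd t).continuousAt
  -- Multiplication by `e^{-iθt}` only shifts the Fourier coefficients, so their absolute sum is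
  -- unchanged, while the derivative loses the drift `iθH`.
  have hd' : ∀ t, HasDerivAt (fun t => chi (-θ) t * H t)
      (chi (-θ) t * (H' t - θ * Complex.I * H t)) t := fun t => by
    refine ((hasDerivAt_chi (-θ) t).mul (hd t)).congr_deriv ?_
    push_cast
    ring
  have hper : H (-π) = H π := by
    refine (h2 (-π)).unique ?_
    simpa only [chi_neg_pi] using h2 π
  obtain ⟨hs, hle⟩ := summable_coeff_and_sq_tsum_le hd' (by fun_prop)
    (by rw [chi_neg_pi, hper]) hb
  simp only [norm_mul, norm_chi, one_mul, coeff_chi_mul] at hs hle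
  have hs' : Summable fun k => ‖coeff H k‖ := (Equiv.addRight θ).summable_iff.mp hs
  have ht : ∑' k, ‖coeff H (k + θ)‖ = ∑' k, ‖coeff H k‖ :=
    (Equiv.addRight θ).tsum_eq fun k => ‖coeff H k‖
  rw [ht] at hle
  refine le_trans ?_ hle
  gcongr
  calc ‖X‖ ≤ ∑' i, |c i| := hv.norm_le_tsum hcs h1
    _ = ∑' i, ‖coeff H (e i)‖ := by
        refine tsum_congr fun i => ?_
        rw [coeff_eq_of_hasSum he hcs h2 i, Complex.norm_real, Real.norm_eq_abs]
    _ ≤ ∑' k, ‖coeff H k‖ := tsum_comp_le_tsum_of_inj hs' (fun _ => norm_nonneg _) he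

end Fourier

end SignedCP

namespace SignedCP

/-! ### Mean values over the circle. -/

section CircleMean

open Real

theorem circleMean_mono {f g : ℝ → ℝ} (hf : Continuous f) (hg : Continuous g)
    (h : ∀ t, f t ≤ g t) : circleMean f ≤ circleMean g := by
  unfold circleMean
  gcongr
  exact intervalIntegral.integral_mono_on neg_pi_lt_pi.le (hf.intervalIntegrable _ _)
    (hg.intervalIntegrable _ _) fun t _ => h t

theorem circleMean_const_mul (c : ℝ) (f : ℝ → ℝ) :
    circleMean (fun t => c * f t) = c * circleMean f := by
  rw [circleMean, circleMean, intervalIntegral.integral_const_mul]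
  ring

theorem circleMean_const (c : ℝ) : circleMean (fun _ => c) = c := by
  rw [circleMean, intervalIntegral.integral_const, smul_eq_mul]
  field_simp
  ring

theorem circleMean_nonneg {f : ℝ → ℝ} (h : ∀ t, 0 ≤ f t) : 0 ≤ circleMean f :=
  mul_nonneg (by positivity)
    (intervalIntegral.integral_nonneg neg_pi_lt_pi.le fun t _ => h t)

theorem circleMean_exp_cos_le_one {s : ℝ} (hs : 0 ≤ s) :
    circleMean (fun t => exp (-(s * (1 - cos t)))) ≤ 1 := by
  refine le_of_le_of_eq ?_ (circleMean_const 1)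
  refine circleMean_mono (by fun_prop) (by fun_prop) fun t => ?_
  rw [exp_le_one_iff]
  have := cos_le_one t
  nlinarith

/-- On `[-π, π]` one has `1 - cos t ≥ 2 t² / π²`, which leads to a Gaussian integral over the line.
-/
theorem circleMean_exp_cos_le {s : ℝ} (hs : 0 < s) :
    circleMean (fun t => exp (-(s * (1 - cos t)))) ≤ 1 / √s := by
  have hpi := pi_pos
  set β : ℝ := s * (2 / π ^ 2) with hβ
  have hβ0 : 0 < β := by positivity
  have h1 : ∫ t in (-π)..π, exp (-(s * (1 - cos t))) ≤ ∫ t in (-π)..π, exp (-β * t ^ 2) := by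
    refine intervalIntegral.integral_mono_on neg_pi_lt_pi.le
      ((by fun_prop : Continuous fun t => exp (-(s * (1 - cos t)))).intervalIntegrable _ _)
      ((by fun_prop : Continuous fun t => exp (-β * t ^ 2)).intervalIntegrable _ _) fun t ht => ?_
    have := cos_le_one_sub_mul_cos_sq (x := t) (abs_le.mpr ht)
    rw [exp_le_exp, hβ]
    nlinarith
  have h2 : ∫ t in (-π)..π, exp (-β * t ^ 2) ≤ √(π / β) := by
    rw [intervalIntegral.integral_of_le neg_pi_lt_pi.le, ← integral_gaussian]
    exact setIntegral_le_integral (integrable_exp_neg_mul_sq hβ0)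
      (Filter.Eventually.of_forall fun t => (exp_pos _).le)
  have h3 : √(π / β) ≤ 2 * π / √s := by
    apply Real.sqrt_le_iff.mpr
    refine ⟨by positivity, ?_⟩
    rw [div_pow, Real.sq_sqrt hs.le, hβ]
    have : π / (s * (2 / π ^ 2)) = π * π ^ 2 / 2 / s := by field_simp
    rw [this]
    gcongr
    nlinarith [pi_le_four, sq_nonneg π]
  calc circleMean (fun t => exp (-(s * (1 - cos t)))) ≤ (2 * π)⁻¹ * (2 * π / √s) := by
        unfold circleMean
        gcongr
        exact h1.trans (h2.trans h3)
    _ = 1 / √s := by field_simp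

/-- The map `t ↦ k t` winds around the circle `|k|` times. Hence every non-zero atom of a lattice
law contributes like the atom at 1. -/
theorem circleMean_comp_int_mul {f : ℝ → ℝ} (hf : Continuous f) (hp : Function.Periodic f (2 * π))
    {k : ℤ} (hk : k ≠ 0) : circleMean (fun t => f (k * t)) = circleMean f := by
  have hk' : (k : ℝ) ≠ 0 := by exact_mod_cast hk
  have h1 := hp.intervalIntegral_add_zsmul_eq k (k * -π) fun a b => hf.intervalIntegrable a b
  have h2 := hp.intervalIntegral_add_eq (k * -π) (-π)
  rw [h2, show -π + 2 * π = π by ring, zsmul_eq_mul, zsmul_eq_mul,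
    show (k : ℝ) * -π + k * (2 * π) = k * π by ring] at h1
  rw [circleMean, circleMean, intervalIntegral.integral_comp_mul_left f hk', h1, smul_eq_mul]
  field_simp

end CircleMean

/-! ### Symmetric laws on the integers and smoothing by their compound Poisson semigroup. -/

section LatticeLaw

open Real

/-- A symmetric probability law on the non-zero integers with variance `σ²`. -/
structure IsSymmetricLaw (P : ℤ → ℝ) (σ : ℝ) : Prop where
  nonneg : ∀ k, 0 ≤ P k
  zero : P 0 = 0
  symm : ∀ k, P (-k) = P k
  hasSum : HasSum P 1
  hasSum_sq : HasSum (fun k : ℤ => (k : ℝ) ^ 2 * P k) (σ ^ 2)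

/-- One minus the characteristic function of a symmetric law on the integers. -/
noncomputable def charGap (P : ℤ → ℝ) (t : ℝ) : ℝ := ∑' k : ℤ, P k * (1 - cos (k * t))

/-- The derivative of `charGap`. -/
noncomputable def charGapDeriv (P : ℤ → ℝ) (t : ℝ) : ℝ := ∑' k : ℤ, P k * (k * sin (k * t))

variable {P : ℤ → ℝ} {σ : ℝ}

namespace IsSymmetricLaw

theorem hasSum_charGap (h : IsSymmetricLaw P σ) (t : ℝ) :
    HasSum (fun k : ℤ => P k * (1 - cos (k * t))) (charGap P t) := by
  refine (Summable.of_norm_bounded (h.hasSum.summable.mul_right 2) fun k => ?_).hasSum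
  rw [norm_mul, norm_of_nonneg (h.nonneg k)]
  refine mul_le_mul_of_nonneg_left ?_ (h.nonneg k)
  rw [Real.norm_eq_abs, abs_le]
  constructor <;> linarith [neg_one_le_cos ((k : ℝ) * t), cos_le_one ((k : ℝ) * t)]

theorem norm_deriv_term_le (h : IsSymmetricLaw P σ) (t : ℝ) (k : ℤ) :
    ‖P k * (k * sin (k * t))‖ ≤ (k : ℝ) ^ 2 * P k := by
  rw [norm_mul, norm_of_nonneg (h.nonneg k), mul_comm]
  refine mul_le_mul_of_nonneg_right ?_ (h.nonneg k)
  rw [norm_mul, Real.norm_eq_abs, Real.norm_eq_abs]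
  have h1 : |(k : ℝ)| ≤ (k : ℝ) ^ 2 := by
    rw [← sq_abs]
    rcases eq_or_ne k 0 with rfl | hk
    · simp
    · have : (1 : ℝ) ≤ |(k : ℝ)| := by exact_mod_cast Int.one_le_abs hk
      nlinarith
  exact (mul_le_of_le_one_right (abs_nonneg _) (abs_sin_le_one _)).trans h1

theorem hasSum_charGapDeriv (h : IsSymmetricLaw P σ) (t : ℝ) :
    HasSum (fun k : ℤ => P k * (k * sin (k * t))) (charGapDeriv P t) :=
  (Summable.of_norm_bounded h.hasSum_sq.summable (h.norm_deriv_term_le t)).hasSum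

theorem hasDerivAt_charGap (h : IsSymmetricLaw P σ) (t : ℝ) :
    HasDerivAt (charGap P) (charGapDeriv P t) t := by
  refine hasDerivAt_tsum (g := fun k : ℤ => fun t : ℝ => P k * (1 - cos (k * t)))
    h.hasSum_sq.summable (fun k t => ?_) (fun k t => h.norm_deriv_term_le t k)
    (h.hasSum_charGap 0).summable t
  have h1 : HasDerivAt (fun t : ℝ => (k : ℝ) * t) k t := by
    simpa using (hasDerivAt_id t).const_mul (k : ℝ)
  refine ((h1.cos.const_sub 1).const_mul (P k)).congr_deriv ?_
  ring

theorem continuous_charGapDeriv (h : IsSymmetricLaw P σ) : Continuous (charGapDeriv P) :=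
  continuous_tsum (fun k => by fun_prop) h.hasSum_sq.summable fun k t => h.norm_deriv_term_le t k

theorem continuous_charGap (h : IsSymmetricLaw P σ) : Continuous (charGap P) :=
  continuous_iff_continuousAt.mpr fun t => (h.hasDerivAt_charGap t).continuousAt

theorem charGap_nonneg (h : IsSymmetricLaw P σ) (t : ℝ) : 0 ≤ charGap P t :=
  (h.hasSum_charGap t).nonneg fun k => mul_nonneg (h.nonneg k) (by linarith [cos_le_one (k * t)])

/-- Cauchy-Schwarz, in discriminant form, between `k` and `sin (k t)` under `P`, followed by `sin² x
≤ 2 (1 - cos x)`. -/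
theorem sq_charGapDeriv_le (h : IsSymmetricLaw P σ) (t : ℝ) :
    charGapDeriv P t ^ 2 ≤ 2 * σ ^ 2 * charGap P t := by
  have hs : Summable fun k : ℤ => P k * sin (k * t) ^ 2 := by
    refine Summable.of_nonneg_of_le (fun k => mul_nonneg (h.nonneg k) (sq_nonneg _)) (fun k => ?_)
      h.hasSum.summable
    exact mul_le_of_le_one_right (h.nonneg k) (sin_sq_le_one _)
  have hle : ∑' k : ℤ, P k * sin (k * t) ^ 2 ≤ 2 * charGap P t := by
    refine hasSum_le (fun k => ?_) hs.hasSum ((h.hasSum_charGap t).mul_left 2)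
    have : P k * sin (k * t) ^ 2 ≤ P k * (2 * (1 - cos (k * t))) := by
      refine mul_le_mul_of_nonneg_left ?_ (h.nonneg k)
      nlinarith [sin_sq_add_cos_sq ((k : ℝ) * t), sq_nonneg (1 - cos ((k : ℝ) * t))]
    linarith
  have hq : ∀ x : ℝ, 0 ≤ σ ^ 2 * (x * x) + (-2 * charGapDeriv P t) * x
      + ∑' k : ℤ, P k * sin (k * t) ^ 2 := by
    intro x
    refine HasSum.nonneg (fun k => ?_) (((h.hasSum_sq.mul_right (x * x)).add
      (((h.hasSum_charGapDeriv t).mul_left (-2)).mul_right x)).add hs.hasSum)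
    have : (0 : ℝ) ≤ P k * (k * x - sin (k * t)) ^ 2 := mul_nonneg (h.nonneg k) (sq_nonneg _)
    nlinarith
  have hd := discrim_le_zero hq
  rw [discrim] at hd
  nlinarith [sq_nonneg σ]

/-- Averaging the terms at `k` and `-k` turns the characters into cosines, by symmetry of the law.
-/
theorem hasSum_chi (h : IsSymmetricLaw P σ) (t : ℝ) :
    HasSum (fun k => P k • chi k t) ((1 - charGap P t : ℝ) : ℂ) := by
  have h1 : Summable fun k => P k • chi k t := by
    refine Summable.of_norm_bounded h.hasSum.summable fun k => ?_
    rw [norm_smul, norm_chi, mul_one, norm_of_nonneg (h.nonneg k)]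
  have h2 : HasSum (fun k : ℤ => P (-k) • chi (-k) t) (∑' k, P k • chi k t) :=
    (Equiv.neg ℤ).hasSum_iff.mpr h1.hasSum
  have h3 := (h1.hasSum.add h2).div_const 2
  have h4 : HasSum (fun k : ℤ => P k * cos (k * t)) (1 - charGap P t) := by
    have := h.hasSum.sub (h.hasSum_charGap t)
    rw [show (fun k : ℤ => P k * cos (k * t)) = fun k : ℤ => P k - P k * (1 - cos (k * t)) from
      funext fun k => by ring]
    exact this
  have h5 : HasSum (fun k : ℤ => ((P k * cos (k * t) : ℝ) : ℂ)) ((1 - charGap P t : ℝ) : ℂ) :=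
    Complex.hasSum_ofReal.mpr h4
  have h6 : ∀ k : ℤ, (P k • chi k t + P (-k) • chi (-k) t) / 2 = ((P k * cos (k * t) : ℝ) : ℂ) := by
    intro k
    rw [h.symm, ← smul_add, Complex.real_smul, chi, chi]
    push_cast
    rw [Complex.cos]
    ring_nf
  simp only [h6, add_self_div_two] at h3
  rw [h5.unique h3]
  exact h1.hasSum

/-- Jensen's inequality bounds `exp(-s charGap)` by the `P`-average of `exp(-s (1 - cos (k t)))`,
and all terms with `k ≠ 0` have the same circle mean. The bound is therefore independent of the law.
-/
theorem circleMean_exp_charGap_le (h : IsSymmetricLaw P σ) {s : ℝ} (hs : 0 ≤ s) :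
    circleMean (fun t => exp (-(s * charGap P t)))
      ≤ circleMean (fun t => exp (-(s * (1 - cos t)))) := by
  have hpt : ∀ t, HasSum (fun k : ℤ => P k * exp (-(s * (1 - cos (k * t)))))
      (∑' k : ℤ, P k * exp (-(s * (1 - cos (k * t))))) := fun t => by
    refine (Summable.of_nonneg_of_le (fun k => mul_nonneg (h.nonneg k) (exp_pos _).le)
      (fun k => mul_le_of_le_one_right (h.nonneg k) ?_) h.hasSum.summable).hasSum
    rw [exp_le_one_iff]
    nlinarith [cos_le_one ((k : ℝ) * t)]
  have hbound : ∀ (k : ℤ) (t : ℝ), ‖P k * exp (-(s * (1 - cos (k * t))))‖ ≤ P k := fun k t => by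
    rw [norm_of_nonneg (mul_nonneg (h.nonneg k) (exp_pos _).le)]
    refine mul_le_of_le_one_right (h.nonneg k) ?_
    rw [exp_le_one_iff]
    nlinarith [cos_le_one ((k : ℝ) * t)]
  have hint : HasSum (fun k : ℤ => circleMean fun t => P k * exp (-(s * (1 - cos (k * t)))))
      (circleMean fun t => ∑' k : ℤ, P k * exp (-(s * (1 - cos (k * t))))) := by
    refine HasSum.mul_left _ ?_
    refine intervalIntegral.hasSum_integral_of_dominated_convergence (fun k _ => P k)
      (fun k => ?_) (fun k => ?_) ?_ ?_ ?_
    · exact (by fun_prop : Continuous fun t =>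
        P k * exp (-(s * (1 - cos (k * t))))).aestronglyMeasurable
    · exact Filter.Eventually.of_forall fun t _ => hbound k t
    · exact Filter.Eventually.of_forall fun t _ => h.hasSum.summable
    · simp
    · exact Filter.Eventually.of_forall fun t _ => hpt t
  have hterm : ∀ k : ℤ, (circleMean fun t => P k * exp (-(s * (1 - cos (k * t)))))
      = P k * circleMean fun t => exp (-(s * (1 - cos t))) := by
    intro k
    rw [circleMean_const_mul]
    rcases eq_or_ne k 0 with rfl | hk
    · simp [h.zero]
    · rw [circleMean_comp_int_mul (f := fun t => exp (-(s * (1 - cos t)))) (by fun_prop)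
        (fun t => by simp) hk]
  simp only [hterm] at hint
  have heq := hint.unique (h.hasSum.mul_right _)
  rw [one_mul] at heq
  rw [← heq]
  have hc := h.continuous_charGap
  refine circleMean_mono (by fun_prop) (continuous_tsum (fun k => by fun_prop) h.hasSum.summable
    hbound) fun t => ?_
  -- Tangent line of the exponential at the mean `charGap P t`: the linear terms average to zero,
  -- which gives Jensen's inequality termwise.
  have h1 : HasSum (fun k : ℤ => P k * (exp (-(s * charGap P t))
      * (1 - s * ((1 - cos (k * t)) - charGap P t)))) (exp (-(s * charGap P t))) := by
    have := ((h.hasSum.mul_right (1 + s * charGap P t)).sub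
      ((h.hasSum_charGap t).mul_left s)).mul_left (exp (-(s * charGap P t)))
    have e : exp (-(s * charGap P t)) * (1 * (1 + s * charGap P t) - s * charGap P t)
        = exp (-(s * charGap P t)) := by ring
    rw [e] at this
    rw [show (fun k : ℤ => P k * (exp (-(s * charGap P t))
        * (1 - s * ((1 - cos (k * t)) - charGap P t)))) = fun k : ℤ => exp (-(s * charGap P t))
        * (P k * (1 + s * charGap P t) - s * (P k * (1 - cos (k * t)))) from
      funext fun k => by ring]
    exact this
  refine hasSum_le (fun k => mul_le_mul_of_nonneg_left ?_ (h.nonneg k)) h1 (hpt t)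
  have h2 := add_one_le_exp (-(s * ((1 - cos (k * t)) - charGap P t)))
  calc _ ≤ exp (-(s * charGap P t)) * exp (-(s * ((1 - cos (k * t)) - charGap P t))) := by
        gcongr
        linarith
    _ = _ := by
        rw [← exp_add]
        ring_nf

variable {A : Type*} [NormedRing A] [NormedAlgebra ℝ A] [CompleteSpace A]

/-- Smoothing property of the compound Poisson semigroup of a symmetric law on the integers. -/
theorem norm_sub_one_mul_exp_le (h : IsSymmetricLaw P σ) (hσ : 0 ≤ σ) {v : ℤ → A}
    (hv : IsContractiveHom v) {X : A} (hX : HasSum (fun k => P k • v k) X) {l : ℝ} (hl : 0 < l) :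
    ‖(X - 1) * NormedSpace.exp (l • (X - 1))‖ ≤ 9 * √(1 + σ) / l := by
  have hχ := isContractiveHom_chi (AddMonoidHom.id ℤ)
  have hS : SameSeries v chi X (fun t => ((1 - charGap P t : ℝ) : ℂ)) :=
    ⟨P, h.hasSum.summable, hX, h.hasSum_chi⟩
  have hS1 := hS.sub (SameSeries.one hv hχ)
  have hS2 := hS1.mul hv hχ ((hS1.smul l).exp hv hχ)
  set H : ℝ → ℂ := fun t => ((-charGap P t * exp (-(l * charGap P t)) : ℝ) : ℂ) with hH
  set H' : ℝ → ℂ := fun t => ((-charGapDeriv P t * (1 - l * charGap P t)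
    * exp (-(l * charGap P t)) : ℝ) : ℂ) with hH'
  have hS3 : SameSeries v (fun k => chi (id k)) ((X - 1) * NormedSpace.exp (l • (X - 1))) H := by
    refine Eq.mp (congrArg (SameSeries v chi _) (funext fun t => ?_)) hS2
    simp only [hH, Pi.mul_apply, Pi.sub_apply, Pi.one_apply, Pi.smul_apply, Complex.real_smul]
    push_cast
    ring_nf
  have hd : ∀ t, HasDerivAt H (H' t) t := by
    intro t
    have h1 := h.hasDerivAt_charGap t
    have h2 := ((h1.neg).mul ((h1.const_mul l).neg.exp)).ofReal_comp
    refine h2.congr_deriv ?_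
    simp only [hH', Pi.neg_apply]
    congr 1
    ring
  have hc1 := h.continuous_charGap
  have hc2 := h.continuous_charGapDeriv
  -- This `b` balances the two mean squares: the derivative costs `σ² / l`, which `b²` reduces to at
  -- most `1 / l²`, while `b J ≤ 1 + σ` because `J ≤ 1 / √l`. Only the first power of `1 + σ`
  -- survives in the squared norm.
  set b : ℝ := (1 + σ) * √l with hb
  have hsl : 0 < √l := Real.sqrt_pos.mpr hl
  have hb0 : 0 < b := by positivity
  have hmain := hS3.sq_norm_le hv Function.injective_id hd (by fun_prop) hb0 0
  simp only [Int.cast_zero, zero_mul, sub_zero] at hmain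
  set J := circleMean fun t => exp (-(l * charGap P t)) with hJ
  have hJ0 : 0 ≤ J := circleMean_nonneg fun t => (exp_pos _).le
  have hJ1 : J ≤ 1 := (h.circleMean_exp_charGap_le hl.le).trans (circleMean_exp_cos_le_one hl.le)
  have hJ2 : J ≤ 1 / √l := (h.circleMean_exp_charGap_le hl.le).trans (circleMean_exp_cos_le hl)
  have m1 : (circleMean fun t => ‖H t‖ ^ 2) ≤ 2 / l ^ 2 * J := by
    rw [← circleMean_const_mul]
    refine circleMean_mono (by fun_prop) (by fun_prop) fun t => ?_
    have hu := h.charGap_nonneg t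
    have h2 : ‖H t‖ ^ 2 = 1 / l ^ 2 * (l * charGap P t) ^ 2
        * (exp (-(l * charGap P t)) * exp (-(l * charGap P t))) := by
      rw [hH, Complex.norm_real, Real.norm_eq_abs, sq_abs]
      field_simp
    set u := charGap P t
    have h1 : (l * u) ^ 2 ≤ 2 * exp (l * u) := by
      have := quadratic_le_exp_of_nonneg (x := l * u) (by positivity)
      nlinarith [mul_nonneg hl.le hu]
    rw [h2]
    calc _ ≤ 1 / l ^ 2 * (2 * exp (l * u)) * (exp (-(l * u)) * exp (-(l * u))) := by gcongr
      _ = 2 / l ^ 2 * ((exp (l * u) * exp (-(l * u))) * exp (-(l * u))) := by ring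
      _ = _ := by rw [← exp_add, add_neg_cancel, exp_zero, one_mul]
  have m2 : (circleMean fun t => ‖H' t‖ ^ 2) ≤ 12 * σ ^ 2 / l * J := by
    rw [← circleMean_const_mul]
    refine circleMean_mono (by fun_prop) (by fun_prop) fun t => ?_
    have hu := h.charGap_nonneg t
    have hu' := h.sq_charGapDeriv_le t
    have h2 : ‖H' t‖ ^ 2 = charGapDeriv P t ^ 2 * (1 - l * charGap P t) ^ 2
        * (exp (-(l * charGap P t)) * exp (-(l * charGap P t))) := by
      rw [hH', Complex.norm_real, Real.norm_eq_abs, sq_abs]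
      ring
    set u := charGap P t
    set u' := charGapDeriv P t
    have hx : 0 ≤ l * u := by positivity
    have h1 : (l * u) * (1 - l * u) ^ 2 ≤ 6 * exp (l * u) := by
      have := sum_le_exp_of_nonneg hx 4
      simp [Finset.sum_range_succ, Nat.factorial] at this
      nlinarith [mul_nonneg hx hx]
    rw [h2]
    calc _ ≤ (2 * σ ^ 2 * u) * (1 - l * u) ^ 2 * (exp (-(l * u)) * exp (-(l * u))) := by gcongr
      _ = 2 * σ ^ 2 / l * ((l * u) * (1 - l * u) ^ 2) * (exp (-(l * u)) * exp (-(l * u))) := by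
          field_simp
      _ ≤ 2 * σ ^ 2 / l * (6 * exp (l * u)) * (exp (-(l * u)) * exp (-(l * u))) := by gcongr
      _ = 12 * σ ^ 2 / l * ((exp (l * u) * exp (-(l * u))) * exp (-(l * u))) := by ring
      _ = _ := by rw [← exp_add, add_neg_cancel, exp_zero, one_mul]
  have hb2 : (b ^ 2)⁻¹ * (12 * σ ^ 2 / l * J) ≤ 12 / l ^ 2 * J := by
    have e : (b ^ 2)⁻¹ * (12 * σ ^ 2 / l * J) = σ ^ 2 / (1 + σ) ^ 2 * (12 / l ^ 2 * J) := by
      rw [hb, mul_pow, Real.sq_sqrt hl.le]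
      field_simp
    rw [e]
    refine mul_le_of_le_one_left (by positivity) ?_
    rw [div_le_one (by positivity)]
    nlinarith
  have hJb : (1 + 4 * b) * J ≤ 5 * (1 + σ) := by
    have : √l * J ≤ 1 := by
      calc √l * J ≤ √l * (1 / √l) := by gcongr
        _ = 1 := by field_simp
    have : b * J ≤ 1 + σ := by
      rw [hb, mul_assoc]
      exact mul_le_of_le_one_right (by positivity) this
    nlinarith
  -- The constants combine to `(2 + 12) * 5 = 70 ≤ 9²`.
  have hfin : ‖(X - 1) * NormedSpace.exp (l • (X - 1))‖ ^ 2 ≤ (9 * √(1 + σ) / l) ^ 2 := by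
    rw [div_pow, mul_pow, Real.sq_sqrt (by positivity)]
    calc _ ≤ _ := hmain
      _ ≤ (1 + 4 * b) * (2 / l ^ 2 * J + (b ^ 2)⁻¹ * (12 * σ ^ 2 / l * J)) := by gcongr
      _ ≤ (1 + 4 * b) * (2 / l ^ 2 * J + 12 / l ^ 2 * J) := by gcongr
      _ = 14 / l ^ 2 * ((1 + 4 * b) * J) := by ring
      _ ≤ 14 / l ^ 2 * (5 * (1 + σ)) := by gcongr
      _ = 70 * (1 + σ) / l ^ 2 := by ring
      _ ≤ _ := by
        gcongr
        norm_num
  exact le_of_sq_le_sq hfin (by positivity)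

end IsSymmetricLaw

end LatticeLaw

end SignedCP

namespace SignedCP

/-! ### The binomial and signed Poisson factors as power series in one contraction. -/

section PowerSeries

open Real

theorem isContractiveHom_pow {A : Type*} [NormedRing A] [NormOneClass A] {G : A} (hG : ‖G‖ ≤ 1) :
    IsContractiveHom fun i : ℕ => G ^ i where
  map_zero := pow_zero G
  map_add := pow_add G
  norm_le i := (norm_pow_le G i).trans (pow_le_one₀ (norm_nonneg _) hG)

theorem chi_one_re (t : ℝ) : (chi 1 t).re = cos t := by
  simp [chi, Complex.exp_ofReal_mul_I_re]

theorem chi_one_im (t : ℝ) : (chi 1 t).im = sin t := by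
  simp [chi, Complex.exp_ofReal_mul_I_im]

theorem sq_norm_chi_one_sub_one (t : ℝ) : ‖chi 1 t - 1‖ ^ 2 = 2 * (1 - cos t) := by
  rw [Complex.sq_norm, Complex.normSq_apply]
  simp only [Complex.sub_re, Complex.sub_im, chi_one_re, chi_one_im, Complex.one_re,
    Complex.one_im]
  nlinarith [sin_sq_add_cos_sq t]

variable {q : ℝ} {j k : ℕ}

/-- The increment `(1 - q) (z - 1)` of the binomial characteristic function. -/
noncomputable def binIncr (q t : ℝ) : ℂ := (1 - q : ℝ) * (chi 1 t - 1)

/-- The exponential factor of the symbol. -/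
noncomputable def symbolExp (q : ℝ) (j k : ℕ) (t : ℝ) : ℂ :=
  Complex.exp (k * (binIncr q t - binIncr q t ^ 2 / 2) - (q / 2 * (j + k) : ℝ) * binIncr q t)

/-- The symbol `(1 + w)^j exp(k (w - w² / 2) - (q / 2) (j + k) w)`, where `w = (1 - q) (z - 1)`. -/
noncomputable def symbol (q : ℝ) (j k : ℕ) (t : ℝ) : ℂ :=
  (1 + binIncr q t) ^ j * symbolExp q j k t

/-- The derivative of `symbol`. -/
noncomputable def symbolDeriv (q : ℝ) (j k : ℕ) (t : ℝ) : ℂ :=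
  Complex.I * (1 - q : ℝ) * chi 1 t * (j * (1 + binIncr q t) ^ (j - 1) +
    (k * (1 - binIncr q t) - (q / 2 * (j + k) : ℝ)) * (1 + binIncr q t) ^ j) * symbolExp q j k t

@[fun_prop]
theorem continuous_binIncr (q : ℝ) : Continuous (binIncr q) := by
  unfold binIncr
  fun_prop

@[fun_prop]
theorem continuous_symbol (q : ℝ) (j k : ℕ) : Continuous (symbol q j k) := by
  unfold symbol symbolExp
  fun_prop

@[fun_prop]
theorem continuous_symbolDeriv (q : ℝ) (j k : ℕ) : Continuous (symbolDeriv q j k) := by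
  unfold symbolDeriv symbolExp
  fun_prop

theorem hasDerivAt_symbol (q : ℝ) (j k : ℕ) (t : ℝ) :
    HasDerivAt (symbol q j k) (symbolDeriv q j k t) t := by
  have h1 : HasDerivAt (binIncr q) ((1 - q : ℝ) * (Complex.I * chi 1 t)) t := by
    refine (((hasDerivAt_chi 1 t).sub_const 1).const_mul ((1 - q : ℝ) : ℂ)).congr_deriv ?_
    simp
  have h2 := ((h1.const_add 1).fun_pow j).mul (((h1.sub ((h1.fun_pow 2).div_const 2)).const_mul
    (k : ℂ)).sub (h1.const_mul ((q / 2 * (j + k) : ℝ) : ℂ))).cexp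
  refine h2.congr_deriv ?_
  simp only [symbolDeriv, symbolExp, Pi.sub_apply]
  push_cast
  ring

/-- With `z = e^{it}`, `|q + (1 - q) z|² = 1 - 2 q (1 - q) (1 - cos t)`, and `1 + x ≤ exp x`. -/
theorem norm_one_add_binIncr_le (q t : ℝ) :
    ‖1 + binIncr q t‖ ≤ exp (-((1 - q) * q * (1 - cos t))) := by
  refine le_of_sq_le_sq ?_ (exp_pos _).le
  have h1 : ‖1 + binIncr q t‖ ^ 2 = 1 - 2 * ((1 - q) * q * (1 - cos t)) := by
    rw [Complex.sq_norm, Complex.normSq_apply]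
    simp only [binIncr, Complex.add_re, Complex.add_im, Complex.re_ofReal_mul,
      Complex.im_ofReal_mul, Complex.sub_re, Complex.sub_im, chi_one_re, chi_one_im, Complex.one_re,
      Complex.one_im]
    linear_combination (1 - q) ^ 2 * sin_sq_add_cos_sq t
  rw [h1, ← exp_nat_mul]
  have := add_one_le_exp (((2 : ℕ) : ℝ) * -((1 - q) * q * (1 - cos t)))
  push_cast at this ⊢
  linarith

/-- The real part of `w - w² / 2` is `-(1 - q) (1 - cos t) (q + (1 - q) (1 - cos t))`, at most `-x`
for `x = (1 - q) q (1 - cos t)`. The removed semigroup part adds exactly `(j + k) x / 2`. -/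
theorem norm_symbolExp_le (q : ℝ) (j k : ℕ) (t : ℝ) :
    ‖symbolExp q j k t‖ ≤ exp (((j : ℝ) - k) / 2 * ((1 - q) * q * (1 - cos t))) := by
  rw [symbolExp, Complex.norm_exp, exp_le_exp]
  have h1 : (binIncr q t).re = -((1 - q) * (1 - cos t)) := by
    simp only [binIncr, Complex.re_ofReal_mul, Complex.sub_re, chi_one_re, Complex.one_re]
    ring
  have h2 : (binIncr q t ^ 2).re = -(2 * (1 - q) ^ 2 * cos t * (1 - cos t)) := by
    rw [pow_two, Complex.mul_re]
    simp only [binIncr, Complex.re_ofReal_mul, Complex.im_ofReal_mul, Complex.sub_re,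
      Complex.sub_im, chi_one_re, chi_one_im, Complex.one_re, Complex.one_im]
    linear_combination -(1 - q) ^ 2 * sin_sq_add_cos_sq t
  have h3 : (k * (binIncr q t - binIncr q t ^ 2 / 2)
      - (q / 2 * (j + k) : ℝ) * binIncr q t : ℂ).re
      = k * ((binIncr q t).re - (binIncr q t ^ 2).re / 2)
        - (q / 2 * (j + k)) * (binIncr q t).re := by
    rw [Complex.sub_re, Complex.re_ofReal_mul, ← Complex.ofReal_natCast, Complex.re_ofReal_mul,
      Complex.sub_re]
    congr 3
    rw [show (binIncr q t ^ 2 / 2 : ℂ) = binIncr q t ^ 2 / ((2 : ℝ) : ℂ) by norm_num,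
      Complex.div_ofReal_re]
  rw [h3, h1, h2]
  have hc := cos_le_one t
  have hk : (0 : ℝ) ≤ k := Nat.cast_nonneg k
  have : 0 ≤ k * ((1 - q) ^ 2 * (1 - cos t) ^ 2) := by positivity
  nlinarith

/-- The subtracted frequency is the drift of the symbol at `t = 0`. What remains is divisible by `z
- 1`, and this zero is later paid for by the exponential decay. -/
theorem norm_symbolDeriv_sub_le (hq : q ∈ Set.Ioo (0 : ℝ) 1) (j k : ℕ) (t : ℝ) :
    ‖symbolDeriv q j k t - ((1 - q) * (j + k) * (1 - q / 2) : ℝ) * Complex.I * symbol q j k t‖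
      ≤ 3 * ((1 - q) * (j + k)) * ‖chi 1 t - 1‖
        * exp (-((j + k) / 2 * ((1 - q) * q * (1 - cos t)))) := by
  obtain ⟨hq0, hq1⟩ := hq
  set z := chi 1 t with hz
  set w := binIncr q t with hw
  set E := symbolExp q j k t with hE
  have hwz : w = (1 - q : ℝ) * (z - 1) := rfl
  set x := (1 - q) * q * (1 - cos t) with hx
  have hx0 : 0 ≤ x := by
    have := cos_le_one t
    have : 0 ≤ 1 - cos t := by linarith
    have : 0 ≤ 1 - q := by linarith
    positivity
  have hx1 : x ≤ 1 / 2 := by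
    have := neg_one_le_cos t
    have h4 : (1 - q) * q ≤ 1 / 4 := by nlinarith [sq_nonneg (q - 1 / 2)]
    have h5 : 0 ≤ (1 - q) * q := by nlinarith
    rw [hx]
    nlinarith
  have n1 : ‖1 + w‖ ≤ exp (-x) := norm_one_add_binIncr_le q t
  have n2 : ‖E‖ ≤ exp (((j : ℝ) - k) / 2 * x) := norm_symbolExp_le q j k t
  set D := exp (-(((j : ℝ) + k) / 2 * x)) with hD
  have n3 : ‖1 + w‖ ^ j * ‖E‖ ≤ D := by
    calc ‖1 + w‖ ^ j * ‖E‖ ≤ exp (-x) ^ j * exp (((j : ℝ) - k) / 2 * x) := by gcongr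
      _ = D := by rw [← exp_nat_mul, ← exp_add, hD]; ring_nf
  -- Differentiation removes one factor `1 + w`, hence one factor `exp(-x)`; as `x ≤ 1 / 2`, this
  -- costs at most 2.
  have n4 : (j : ℝ) * (‖1 + w‖ ^ (j - 1) * ‖E‖) ≤ j * (2 * D) := by
    rcases Nat.eq_zero_or_pos j with hj | hj
    · simp [hj]
    have hj1 : ((j - 1 : ℕ) : ℝ) = j - 1 := by
      rw [Nat.cast_sub hj, Nat.cast_one]
    have h2 : exp x ≤ 2 := by
      calc exp x ≤ exp (1 / 2) := exp_le_exp.mpr hx1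
        _ ≤ 2 := by
          have h3 : exp (1 / 2) ^ 2 ≤ 2 ^ 2 := by
            rw [← exp_nat_mul]
            norm_num
            linarith [exp_one_lt_d9]
          exact le_of_sq_le_sq h3 (by norm_num)
    refine mul_le_mul_of_nonneg_left ?_ (Nat.cast_nonneg j)
    calc ‖1 + w‖ ^ (j - 1) * ‖E‖ ≤ exp (-x) ^ (j - 1) * exp (((j : ℝ) - k) / 2 * x) := by gcongr
      _ = exp x * D := by rw [← exp_nat_mul, ← exp_add, hD, hj1, ← exp_add]; ring_nf
      _ ≤ 2 * D := by gcongr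
  -- The factor `z - 1` comes from `z - (1 + w) = q (z - 1)`.
  have hpow : (j : ℂ) * z * (1 + w) ^ (j - 1) - j * (1 + w) ^ j
      = j * (1 + w) ^ (j - 1) * ((q : ℝ) * (z - 1)) := by
    rcases Nat.eq_zero_or_pos j with hj | hj
    · simp [hj]
    obtain ⟨i, rfl⟩ : ∃ i, j = i + 1 := ⟨j - 1, by omega⟩
    rw [Nat.add_sub_cancel, pow_succ, hwz]
    push_cast
    ring
  have hid : symbolDeriv q j k t
      - ((1 - q) * (j + k) * (1 - q / 2) : ℝ) * Complex.I * symbol q j k t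
      = Complex.I * (1 - q : ℝ) * (z - 1) * ((q : ℝ) * (j * (1 + w) ^ (j - 1) * E)
        + (k * (1 - (1 - q : ℝ) * z) - (q / 2 * (j + k) : ℝ)) * ((1 + w) ^ j * E)) := by
    rw [symbolDeriv, symbol]
    rw [← hz, ← hw, ← hE]
    have e1 : z * (1 - w) - 1 = (z - 1) * (1 - (1 - q : ℝ) * z) := by rw [hwz]; ring
    push_cast at hpow e1 ⊢
    linear_combination (Complex.I * (1 - q) * E) * hpow
      + (Complex.I * (1 - q) * E * k * (1 + w) ^ j) * e1
  rw [hid]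
  have hz1 : ‖z‖ = 1 := norm_chi 1 t
  have np : ‖((1 - q : ℝ) : ℂ)‖ = 1 - q := by
    rw [Complex.norm_real, Real.norm_eq_abs, abs_of_pos (by linarith)]
  have nq : ‖(q : ℂ)‖ = q := by
    rw [Complex.norm_real, Real.norm_eq_abs, abs_of_pos hq0]
  have nm : ‖((q / 2 * (j + k) : ℝ) : ℂ)‖ = q / 2 * (j + k) := by
    rw [Complex.norm_real, Real.norm_eq_abs, abs_of_nonneg (by positivity)]
  have nA : ‖(q : ℂ) * (j * (1 + w) ^ (j - 1) * E)‖ ≤ j * (2 * D) := by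
    rw [norm_mul, nq, norm_mul, norm_mul, norm_pow, Complex.norm_natCast, mul_assoc]
    exact (mul_le_of_le_one_left (by positivity) hq1.le).trans n4
  have nB : ‖(k * (1 - (1 - q : ℝ) * z) - (q / 2 * (j + k) : ℝ) : ℂ)‖
      ≤ 2 * k + (j + k) / 2 := by
    refine (norm_sub_le _ _).trans (add_le_add ?_ ?_)
    · rw [norm_mul, Complex.norm_natCast, mul_comm]
      gcongr
      refine (norm_sub_le _ _).trans ?_
      rw [norm_mul, np, hz1, norm_one]
      linarith
    · rw [nm]
      have : (0 : ℝ) ≤ j + k := by positivity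
      nlinarith
  have nC : ‖(k * (1 - (1 - q : ℝ) * z) - (q / 2 * (j + k) : ℝ) : ℂ) * ((1 + w) ^ j * E)‖
      ≤ (2 * k + (j + k) / 2) * D := by
    rw [norm_mul, norm_mul ((1 + w) ^ j), norm_pow]
    gcongr
  rw [norm_mul, norm_mul, norm_mul, Complex.norm_I, np, one_mul]
  have hD0 : 0 < D := exp_pos _
  have hp0 : 0 ≤ 1 - q := by linarith
  calc _ ≤ (1 - q) * ‖z - 1‖ * (j * (2 * D) + (2 * k + (j + k) / 2) * D) := by
        gcongr
        exact (norm_add_le _ _).trans (add_le_add nA nC)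
    _ ≤ (1 - q) * ‖z - 1‖ * (3 * (j + k) * D) := by
        gcongr
        have : (0 : ℝ) ≤ (j + k) * D := by positivity
        nlinarith
    _ = _ := by ring

theorem norm_symbol_le (q : ℝ) (j k : ℕ) (t : ℝ) :
    ‖symbol q j k t‖ ≤ exp (-((j + k) / 2 * ((1 - q) * q * (1 - cos t)))) := by
  rw [symbol, norm_mul, norm_pow]
  calc _ ≤ exp (-((1 - q) * q * (1 - cos t))) ^ j
        * exp (((j : ℝ) - k) / 2 * ((1 - q) * q * (1 - cos t))) := by
        gcongr
        · exact norm_one_add_binIncr_le q t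
        · exact norm_symbolExp_le q j k t
    _ = _ := by
        rw [← exp_nat_mul, ← exp_add]
        ring_nf

/-- Only an integer frequency can be removed from a Fourier series, so the drift is replaced by its
floor; its fractional part costs one more copy of the symbol. The squared zero `|z - 1|²` is
absorbed by half of the exponent. -/
theorem sq_norm_symbolDeriv_sub_le (hq : q ∈ Set.Ioo (0 : ℝ) 1) (j k : ℕ) (t : ℝ) {s : ℝ}
    (hs : s = (j + k) * ((1 - q) * q)) :
    ‖symbolDeriv q j k t - (⌊(1 - q) * (j + k) * (1 - q / 2)⌋ : ℤ) * Complex.I * symbol q j k t‖ ^ 2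
      ≤ 36 * ((1 + s) / q ^ 2) * exp (-(s / 2 * (1 - cos t))) := by
  have h1 := norm_symbolDeriv_sub_le hq j k t
  have h2 := norm_symbol_le q j k t
  obtain ⟨hq0, hq1⟩ := hq
  have hp0 : 0 < 1 - q := by linarith
  have hs0 : 0 ≤ s := by rw [hs]; positivity
  set y : ℝ := s * (1 - cos t) with hy
  have hy0 : 0 ≤ y := mul_nonneg hs0 (by linarith [cos_le_one t])
  have e1 : -(((j : ℝ) + k) / 2 * ((1 - q) * q * (1 - cos t))) = -(y / 2) := by rw [hy, hs]; ring
  rw [e1] at h1 h2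
  set a := symbolDeriv q j k t
    - ((1 - q) * (j + k) * (1 - q / 2) : ℝ) * Complex.I * symbol q j k t with ha
  have h3 : ‖symbolDeriv q j k t
      - (⌊(1 - q) * (j + k) * (1 - q / 2)⌋ : ℤ) * Complex.I * symbol q j k t‖
      ≤ ‖a‖ + ‖symbol q j k t‖ := by
    have e : symbolDeriv q j k t
        - (⌊(1 - q) * (j + k) * (1 - q / 2)⌋ : ℤ) * Complex.I * symbol q j k t
        = a + ((Int.fract ((1 - q) * (j + k) * (1 - q / 2)) : ℝ) : ℂ) * Complex.I
          * symbol q j k t := by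
      rw [ha, Int.fract]
      push_cast
      ring
    rw [e]
    refine (norm_add_le _ _).trans (add_le_add le_rfl ?_)
    rw [norm_mul, norm_mul, Complex.norm_I, Complex.norm_real, Real.norm_eq_abs, mul_one,
      abs_of_nonneg (Int.fract_nonneg _)]
    exact mul_le_of_le_one_left (norm_nonneg _) (Int.fract_lt_one _).le
  have h4 : y ≤ exp (y / 2) := by
    have := quadratic_le_exp_of_nonneg (x := y / 2) (by positivity)
    nlinarith [sq_nonneg (y / 2 - 2)]
  have h5 : ‖a‖ ^ 2 ≤ 18 * (s / q ^ 2) * exp (-(y / 2)) := by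
    calc ‖a‖ ^ 2
        ≤ (3 * ((1 - q) * (j + k)) * ‖chi 1 t - 1‖ * exp (-(y / 2))) ^ 2 := by gcongr
      _ = 9 * ((1 - q) * (j + k)) ^ 2 * ‖chi 1 t - 1‖ ^ 2
          * (exp (-(y / 2)) * exp (-(y / 2))) := by ring
      _ = 18 * (s / q ^ 2) * y * (exp (-(y / 2)) * exp (-(y / 2))) := by
          rw [sq_norm_chi_one_sub_one, hy, hs]
          field_simp
          ring
      _ ≤ 18 * (s / q ^ 2) * exp (y / 2) * (exp (-(y / 2)) * exp (-(y / 2))) := by gcongr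
      _ = 18 * (s / q ^ 2) * ((exp (y / 2) * exp (-(y / 2))) * exp (-(y / 2))) := by ring
      _ = _ := by rw [← exp_add, add_neg_cancel, exp_zero, one_mul]
  have h6 : ‖symbol q j k t‖ ^ 2 ≤ exp (-(y / 2)) := by
    calc _ ≤ exp (-(y / 2)) ^ 2 := by gcongr
      _ ≤ exp (-(y / 2)) := by
        rw [pow_two]
        exact mul_le_of_le_one_left (exp_pos _).le (exp_le_one_iff.mpr (by linarith))
  have e2 : -(s / 2 * (1 - cos t)) = -(y / 2) := by rw [hy]; ring
  rw [e2]
  calc _ ≤ (‖a‖ + ‖symbol q j k t‖) ^ 2 := by gcongr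
    _ ≤ 2 * (‖a‖ ^ 2 + ‖symbol q j k t‖ ^ 2) := by
        nlinarith [sq_nonneg (‖a‖ - ‖symbol q j k t‖)]
    _ ≤ 2 * (18 * (s / q ^ 2) * exp (-(y / 2)) + exp (-(y / 2))) := by gcongr
    _ = (36 * (s / q ^ 2) + 2 * 1) * exp (-(y / 2)) := by ring
    _ ≤ (36 * (s / q ^ 2) + 36 * (1 / q ^ 2)) * exp (-(y / 2)) := by
        have h7 : 1 ≤ 1 / q ^ 2 := by
          rw [le_div_iff₀ (by positivity)]
          nlinarith
        have := exp_pos (-(y / 2))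
        nlinarith
    _ = _ := by ring

/-- For `s ≤ 2` the mean is at most 1; for larger `s` the Gaussian bound applies. -/
theorem sqrt_mul_circleMean_exp_le {s : ℝ} (hs : 0 ≤ s) :
    √(1 + s) * circleMean (fun t => exp (-(s / 2 * (1 - cos t)))) ≤ 2 := by
  have hJ : 0 ≤ circleMean (fun t => exp (-(s / 2 * (1 - cos t)))) :=
    circleMean_nonneg fun t => (exp_pos _).le
  rcases le_total s 2 with h | h
  · have h1 : √(1 + s) ≤ 2 := by
      rw [Real.sqrt_le_iff]
      constructor <;> linarith
    have h2 := circleMean_exp_cos_le_one (s := s / 2) (by positivity)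
    nlinarith
  · have h0 : 0 < s / 2 := by positivity
    have h1 : √(1 + s) ≤ 2 * √(s / 2) := by
      rw [Real.sqrt_le_iff]
      refine ⟨by positivity, ?_⟩
      rw [mul_pow, Real.sq_sqrt h0.le]
      linarith
    have h2 : 0 < √(s / 2) := Real.sqrt_pos.mpr h0
    calc _ ≤ (2 * √(s / 2)) * (1 / √(s / 2)) :=
          mul_le_mul h1 (circleMean_exp_cos_le h0) hJ (by positivity)
      _ = 2 := by field_simp

variable {A : Type*} [NormedRing A] [NormOneClass A] [NormedAlgebra ℝ A] [CompleteSpace A]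

/-- Uniform bound on the binomial power times the second order signed Poisson exponential, after
removal of a part of the semigroup. -/
theorem norm_binomial_mul_exp_le (hq : q ∈ Set.Ioo (0 : ℝ) 1) {G w : A} (hG : ‖G‖ ≤ 1)
    (hw : w = (1 - q) • (G - 1)) (j k : ℕ) :
    ‖(1 + w) ^ j * NormedSpace.exp ((k : ℝ) • (w - (1 / 2 : ℝ) • w ^ 2)
      - (q / 2 * (j + k)) • w)‖ ≤ 20 / √q := by
  have hv := isContractiveHom_pow hG
  have hχ := isContractiveHom_chi (Nat.castAddMonoidHom ℤ)
  have hG1 : SameSeries (fun i : ℕ => G ^ i) (fun i => chi (Nat.castAddMonoidHom ℤ i)) G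
      (chi 1) := by
    simpa using SameSeries.basis (fun i : ℕ => G ^ i) (fun i => chi (Nat.castAddMonoidHom ℤ i)) 1
  have hone := SameSeries.one hv hχ
  have hW := (hG1.sub hone).smul (1 - q)
  rw [← hw] at hW
  have hS := ((hone.add hW).pow hv hχ j).mul hv hχ
    ((((hW.sub ((hW.pow hv hχ 2).smul (1 / 2))).smul (k : ℝ)).sub
      (hW.smul (q / 2 * (j + k)))).exp hv hχ)
  have hS2 : SameSeries (fun i : ℕ => G ^ i) (fun i => chi ((fun i : ℕ => (i : ℤ)) i))
      ((1 + w) ^ j * NormedSpace.exp ((k : ℝ) • (w - (1 / 2 : ℝ) • w ^ 2)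
      - (q / 2 * (j + k)) • w)) (symbol q j k) := by
    refine Eq.mp (congrArg (SameSeries _ _ _) (funext fun t => ?_)) hS
    simp only [symbol, symbolExp, binIncr, Pi.mul_apply, Pi.pow_apply, Pi.add_apply, Pi.one_apply,
      Pi.smul_apply, Pi.sub_apply, Complex.real_smul]
    push_cast
    ring_nf
  obtain ⟨hq0, hq1⟩ := id hq
  have hp0 : 0 < 1 - q := by linarith
  obtain ⟨s, hs⟩ : ∃ s : ℝ, s = (j + k) * ((1 - q) * q) := ⟨_, rfl⟩
  have hs0 : 0 ≤ s := by rw [hs]; positivity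
  -- With this `b` the derivative contributes `36 J` to the symbol's `J`. Since `b ≥ 1` and `b J ≤ 2
  -- / q`, the squared norm is at most `5 * 37 * 2 / q = 370 / q`, below `20² / q`.
  obtain ⟨b, hb⟩ : ∃ b : ℝ, b = √(1 + s) / q := ⟨_, rfl⟩
  have hs1 : 1 ≤ √(1 + s) := Real.one_le_sqrt.mpr (by linarith)
  have hb1 : 1 ≤ b := by
    rw [hb, le_div_iff₀ hq0]
    linarith
  have hb0 : 0 < b := by linarith
  have hb2 : b ^ 2 = (1 + s) / q ^ 2 := by
    rw [hb, div_pow, Real.sq_sqrt (by positivity)]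
  have hmain := hS2.sq_norm_le hv Nat.cast_injective (hasDerivAt_symbol q j k)
    (continuous_symbolDeriv q j k) hb0 ⌊(1 - q) * (j + k) * (1 - q / 2)⌋
  obtain ⟨J, hJ⟩ : ∃ J : ℝ, J = circleMean fun t => exp (-(s / 2 * (1 - cos t))) := ⟨_, rfl⟩
  have m1 : (circleMean fun t => ‖symbol q j k t‖ ^ 2) ≤ J := by
    rw [hJ]
    refine circleMean_mono (by fun_prop) (by fun_prop) fun t => ?_
    calc ‖symbol q j k t‖ ^ 2
        ≤ exp (-((j + k) / 2 * ((1 - q) * q * (1 - cos t)))) ^ 2 := by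
          gcongr
          exact norm_symbol_le q j k t
      _ ≤ _ := by
          rw [← exp_nat_mul, exp_le_exp]
          have : 0 ≤ s * (1 - cos t) := mul_nonneg hs0 (by linarith [cos_le_one t])
          rw [hs] at this ⊢
          push_cast
          linarith
  have m2 : (circleMean fun t => ‖symbolDeriv q j k t
      - (⌊(1 - q) * (j + k) * (1 - q / 2)⌋ : ℤ) * Complex.I * symbol q j k t‖ ^ 2)
      ≤ 36 * b ^ 2 * J := by
    rw [hJ, ← circleMean_const_mul, hb2]
    exact circleMean_mono (by fun_prop) (by fun_prop) fun t =>
      sq_norm_symbolDeriv_sub_le hq j k t hs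
  have hJ0 : 0 ≤ J := hJ ▸ circleMean_nonneg fun t => (exp_pos _).le
  have hJ2 : b * J ≤ 2 / q := by
    rw [hb, hJ, div_mul_eq_mul_div]
    exact div_le_div_of_nonneg_right (sqrt_mul_circleMean_exp_le hs0) hq0.le
  refine le_of_sq_le_sq ?_ (by positivity)
  rw [div_pow, Real.sq_sqrt hq0.le]
  refine hmain.trans ?_
  calc _ ≤ (1 + 4 * b) * (J + (b ^ 2)⁻¹ * (36 * b ^ 2 * J)) := by gcongr
    _ = (1 + 4 * b) * (37 * J) := by
        field_simp
        ring
    _ ≤ (b + 4 * b) * (37 * J) := by gcongr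
    _ = 185 * (b * J) := by ring
    _ ≤ 185 * (2 / q) := by gcongr
    _ = 370 / q := by ring
    _ ≤ 20 ^ 2 / q := by
        gcongr
        norm_num

end PowerSeries

end SignedCP

namespace SignedCP

/-! ### The approximation in a commutative Banach algebra. -/

section BanachAlgebra

open Finset

variable {A : Type*} [NormedCommRing A] [NormedAlgebra ℝ A]

theorem sum_smul_sub_one {κ : Type*} (s : Finset κ) (p : κ → ℝ) (X : κ → A) :
    ∑ m ∈ s, p m • (X m - 1) = ∑ m ∈ s, p m • X m - (∑ m ∈ s, p m) • (1 : A) := by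
  rw [sum_smul, ← sum_sub_distrib]
  simp only [smul_sub]

theorem norm_expTerm_le [NormOneClass A] (x : A) (j : ℕ) :
    ‖((j.factorial : ℝ))⁻¹ • x ^ j‖ ≤ ‖x‖ ^ j / j.factorial := by
  rw [norm_smul, norm_inv, Real.norm_eq_abs, Nat.abs_cast, div_eq_inv_mul]
  gcongr
  exact norm_pow_le x j

variable [CompleteSpace A]

theorem exp_add' (x y : A) :
    NormedSpace.exp (x + y) = NormedSpace.exp x * NormedSpace.exp y := by
  let : NormedAlgebra ℚ A := NormedAlgebra.restrictScalars ℚ ℝ A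
  exact NormedSpace.exp_add_of_commute (Commute.all x y)

theorem exp_natCast_smul (n : ℕ) (x : A) :
    NormedSpace.exp ((n : ℝ) • x) = NormedSpace.exp x ^ n := by
  induction n with
  | zero => simp
  | succ n ih => rw [Nat.cast_succ, add_smul, one_smul, exp_add', ih, pow_succ]

theorem norm_exp_le [NormOneClass A] (x : A) : ‖NormedSpace.exp x‖ ≤ Real.exp ‖x‖ := by
  have h := NormedSpace.expSeries_div_hasSum_exp ‖x‖
  rw [← Real.exp_eq_exp_ℝ] at h
  exact (hasSum_exp x).norm_le_of_bounded h (norm_expTerm_le x)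

theorem exp_smul_one (c : ℝ) : NormedSpace.exp (c • (1 : A)) = Real.exp c • (1 : A) := by
  have h := (hasSum_exp c).smul_const (1 : A)
  rw [← Real.exp_eq_exp_ℝ] at h
  refine (hasSum_exp (c • (1 : A))).unique ?_
  simpa only [smul_pow, one_pow, smul_assoc] using h

/-- The scalar factor `exp(-c)` compensates the norm `exp ‖x‖`. This makes compound Poisson
exponentials contractions. -/
theorem norm_exp_sub_smul_one_le [NormOneClass A] {x : A} {c : ℝ} (hx : ‖x‖ ≤ c) :
    ‖NormedSpace.exp (x - c • (1 : A))‖ ≤ 1 := by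
  rw [sub_eq_add_neg, ← neg_smul, exp_add', exp_smul_one, mul_smul_comm, mul_one, norm_smul,
    Real.norm_eq_abs, abs_of_pos (Real.exp_pos _)]
  calc _ ≤ Real.exp (-c) * Real.exp c := by
        gcongr
        exact (norm_exp_le x).trans (Real.exp_le_exp.mpr hx)
    _ = 1 := by rw [← Real.exp_add, neg_add_cancel, Real.exp_zero]

/-- Taylor expansion of the exponential to the third order. -/
theorem exists_exp_eq_taylor [NormOneClass A] (x : A) :
    ∃ r : A, NormedSpace.exp x = 1 + x + (1 / 2 : ℝ) • x ^ 2 + x ^ 3 * r ∧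
      ‖r‖ ≤ Real.exp ‖x‖ := by
  have hle : ∀ j : ℕ, ‖(((j + 3).factorial : ℝ))⁻¹ • x ^ j‖ ≤ ‖x‖ ^ j / j.factorial := by
    intro j
    rw [norm_smul, norm_inv, Real.norm_eq_abs, Nat.abs_cast, div_eq_inv_mul]
    gcongr
    · omega
    · exact norm_pow_le x j
  have h := NormedSpace.expSeries_div_hasSum_exp ‖x‖
  rw [← Real.exp_eq_exp_ℝ] at h
  have hs : Summable fun j : ℕ => (((j + 3).factorial : ℝ))⁻¹ • x ^ j :=
    Summable.of_norm_bounded h.summable hle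
  refine ⟨∑' j : ℕ, (((j + 3).factorial : ℝ))⁻¹ • x ^ j, ?_, hs.hasSum.norm_le_of_bounded h hle⟩
  have h1 := (hasSum_nat_add_iff' 3).mpr (hasSum_exp x)
  have h2 : HasSum (fun j : ℕ => (((j + 3).factorial : ℝ))⁻¹ • x ^ (j + 3))
      (x ^ 3 * ∑' j : ℕ, (((j + 3).factorial : ℝ))⁻¹ • x ^ j) := by
    have := hs.hasSum.mul_left (x ^ 3)
    simpa only [mul_smul_comm, ← pow_add, add_comm 3] using this
  have h3 := h1.unique h2
  rw [sub_eq_iff_eq_add] at h3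
  rw [h3]
  simp [sum_range_succ, Nat.factorial]
  ring

/-- The first order factor `w exp(c w)` of a mixture of smoothing directions. -/
theorem norm_mul_exp_mixture_le [NormOneClass A] {K : ℕ} {p : Fin K → ℝ} (hp : ∀ m, 0 < p m)
    {X : Fin K → A} (hX : ∀ m, ‖X m‖ ≤ 1) {B : Fin K → ℝ}
    (hB : ∀ m, ∀ l : ℝ, 0 < l → ‖(X m - 1) * NormedSpace.exp (l • (X m - 1))‖ ≤ B m / l)
    {c : ℝ} (hc : 0 < c) :
    ‖(∑ m, p m • (X m - 1)) * NormedSpace.exp (c • ∑ m, p m • (X m - 1))‖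
      ≤ (∑ m, B m) / c := by
  rw [sum_mul, sum_div]
  refine (norm_sum_le _ _).trans (sum_le_sum fun m _ => ?_)
  -- Only direction `m` smooths its own increment; the other directions form a contraction. The
  -- smoothing time `c * p m` cancels the weight `p m` in front.
  have e1 : c • ∑ l, p l • (X l - 1) = (c * p m) • (X m - 1)
      + c • ∑ l ∈ univ.erase m, p l • (X l - 1) := by
    rw [← add_sum_erase univ _ (mem_univ m), smul_add, smul_smul]
  have e2 : c • ∑ l ∈ univ.erase m, p l • (X l - 1)
      = (c • ∑ l ∈ univ.erase m, p l • X l) - (c * ∑ l ∈ univ.erase m, p l) • (1 : A) := by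
    rw [sum_smul_sub_one, smul_sub, smul_smul]
  have h1 : ‖NormedSpace.exp (c • ∑ l ∈ univ.erase m, p l • (X l - 1))‖ ≤ 1 := by
    rw [e2]
    refine norm_exp_sub_smul_one_le ?_
    rw [norm_smul, Real.norm_eq_abs, abs_of_pos hc]
    gcongr
    refine (norm_sum_le _ _).trans (sum_le_sum fun l _ => ?_)
    rw [norm_smul, Real.norm_eq_abs, abs_of_pos (hp l)]
    exact mul_le_of_le_one_right (hp l).le (hX l)
  rw [e1, exp_add', ← mul_assoc, smul_mul_assoc]
  refine (norm_mul_le _ _).trans ?_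
  refine (mul_le_of_le_one_right (norm_nonneg _) h1).trans ?_
  rw [norm_smul, Real.norm_eq_abs, abs_of_pos (hp m)]
  calc _ ≤ p m * (B m / (c * p m)) := by
        refine mul_le_mul_of_nonneg_left (hB m _ ?_) (hp m).le
        exact mul_pos hc (hp m)
    _ = B m / c := by
        have := (hp m).ne'
        field_simp

/-- Factorization of `1 + w - exp(w - w² / 2)` through `w³`. -/
theorem exists_one_add_sub_exp_eq [NormOneClass A] {w : A} (hw : ‖w‖ ≤ 2) :
    ∃ r : A, 1 + w - NormedSpace.exp (w - (1 / 2 : ℝ) • w ^ 2) = w ^ 3 * r ∧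
      ‖r‖ ≤ 1 + 8 * Real.exp 4 := by
  obtain ⟨r, hr, hr'⟩ := exists_exp_eq_taylor (w - (1 / 2 : ℝ) • w ^ 2)
  have n0 : ‖w ^ 2‖ ≤ 4 := by
    refine (norm_pow_le w 2).trans ?_
    nlinarith [norm_nonneg w]
  have n1 : ‖w - (1 / 2 : ℝ) • w ^ 2‖ ≤ 4 := by
    refine (norm_sub_le _ _).trans ?_
    rw [norm_smul]
    norm_num
    linarith
  have n2 : ‖1 - (1 / 2 : ℝ) • w‖ ≤ 2 := by
    refine (norm_sub_le _ _).trans ?_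
    rw [norm_smul, norm_one]
    norm_num
    linarith
  -- For `V = w - w² / 2`, `1 + V + V² / 2 = 1 + w - w³ / 2 + w⁴ / 8`, and `V³ = w³ (1 - w / 2)³`
  -- carries the Taylor remainder.
  refine ⟨(1 / 2 : ℝ) • 1 - (1 / 8 : ℝ) • w - (1 - (1 / 2 : ℝ) • w) ^ 3 * r, ?_, ?_⟩
  · rw [hr]
    simp only [Algebra.smul_def, mul_one]
    set h := algebraMap ℝ A (1 / 2) with hh
    have e1 : algebraMap ℝ A (1 / 8) = h ^ 3 := by
      rw [hh, ← map_pow]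
      norm_num
    have e2 : 2 * h = 1 := by
      rw [hh, ← map_ofNat (algebraMap ℝ A) 2, ← map_mul]
      norm_num
    rw [e1]
    linear_combination (w ^ 3 * h) * e2
  · calc _ ≤ ‖(1 / 2 : ℝ) • (1 : A)‖ + ‖(1 / 8 : ℝ) • w‖ + ‖(1 - (1 / 2 : ℝ) • w) ^ 3 * r‖ :=
          (norm_sub_le _ _).trans (add_le_add (norm_sub_le _ _) le_rfl)
      _ ≤ 1 / 2 + 1 / 8 * 2 + 2 ^ 3 * Real.exp 4 := by
          gcongr
          · simp [norm_smul]
          · rw [norm_smul]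
            norm_num
            linarith
          · refine (norm_mul_le _ _).trans ?_
            gcongr
            · exact (norm_pow_le _ 3).trans (by gcongr)
            · exact hr'.trans (Real.exp_le_exp.mpr n1)
      _ ≤ _ := by linarith

/-- The absolute constant of the approximation. -/
noncomputable def hippConst : ℝ := 54 ^ 3 * ((1 + 8 * Real.exp 4) * (20 * Real.exp 1))

/-- Second order signed compound Poisson approximation in a commutative Banach algebra. -/
theorem norm_pow_sub_exp_le [NormOneClass A] {K n : ℕ} (hn : 1 ≤ n) {q : ℝ}
    (hq : q ∈ Set.Ioo (0 : ℝ) 1) {p : Fin K → ℝ} (hp : ∀ m, 0 < p m) (hsum : ∑ m, p m = 1 - q)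
    {P : Fin K → ℤ → ℝ} {σ : Fin K → ℝ} (hσ : ∀ m, 0 ≤ σ m)
    (hP : ∀ m, IsSymmetricLaw (P m) (σ m)) {v : Fin K → ℤ → A}
    (hv : ∀ m, IsContractiveHom (v m)) {X : Fin K → A}
    (hX : ∀ m, HasSum (fun k => P m k • v m k) (X m)) {w : A}
    (hw : w = ∑ m, p m • (X m - 1)) :
    ‖(1 + w) ^ n - NormedSpace.exp ((n : ℝ) • (w - (1 / 2 : ℝ) • w ^ 2))‖
      ≤ hippConst * (∑ m, √(1 + σ m)) ^ 3 / ((n : ℝ) ^ 2 * (q ^ 3 * √q)) := by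
  obtain ⟨hq0, hq1⟩ := id hq
  have hp0 : 0 < 1 - q := by linarith
  have hn0 : (0 : ℝ) < n := by exact_mod_cast hn
  have hX1 : ∀ m, ‖X m‖ ≤ 1 := fun m => by
    refine ((hv m).norm_le_tsum (hP m).hasSum.summable (hX m)).trans ?_
    simp only [abs_of_nonneg ((hP m).nonneg _), (hP m).hasSum.tsum_eq, le_refl]
  have hwX : w = ∑ m, p m • X m - (1 - q) • (1 : A) := by
    rw [hw, ← hsum, sum_smul_sub_one]
  have hXs : ‖∑ m, p m • X m‖ ≤ 1 - q := by
    rw [← hsum]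
    refine (norm_sum_le _ _).trans (sum_le_sum fun m _ => ?_)
    rw [norm_smul, Real.norm_eq_abs, abs_of_pos (hp m)]
    exact mul_le_of_le_one_right (hp m).le (hX1 m)
  obtain ⟨G, hGdef⟩ : ∃ G : A, G = (1 - q)⁻¹ • ∑ m, p m • X m := ⟨_, rfl⟩
  have hG : ‖G‖ ≤ 1 := by
    rw [hGdef, norm_smul, norm_inv, Real.norm_eq_abs, abs_of_pos hp0]
    calc _ ≤ (1 - q)⁻¹ * (1 - q) := by gcongr
      _ = 1 := inv_mul_cancel₀ hp0.ne'
  have hwG : w = (1 - q) • (G - 1) := by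
    rw [hGdef, smul_sub, smul_smul, mul_inv_cancel₀ hp0.ne', one_smul, hwX]
  have hw2 : ‖w‖ ≤ 2 := by
    rw [hwX]
    refine (norm_sub_le _ _).trans ?_
    rw [norm_smul, norm_one, Real.norm_eq_abs, abs_of_pos hp0]
    linarith
  obtain ⟨r, hr, hr'⟩ := exists_one_add_sub_exp_eq hw2
  set V := w - (1 / 2 : ℝ) • w ^ 2 with hV
  set S := ∑ m, √(1 + σ m) with hS
  -- A third of `q n / 2`: one share for each factor of `w³`. It turns the constant 9 of the
  -- smoothing bound into `9 * 6 = 54`.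
  set c : ℝ := q / 6 * n with hc
  have hc0 : 0 < c := by positivity
  have hsm : ‖w * NormedSpace.exp (c • w)‖ ≤ 54 * S / (q * n) := by
    have h1 := norm_mul_exp_mixture_le hp hX1 (B := fun m => 9 * √(1 + σ m))
      (fun m l hl => (hP m).norm_sub_one_mul_exp_le (hσ m) (hv m) (hX m) hl) hc0
    rw [← hw, ← mul_sum] at h1
    refine h1.trans (le_of_eq ?_)
    rw [hc]
    field_simp
    ring
  have hcube : w ^ 3 = (w * NormedSpace.exp (c • w)) ^ 3
      * NormedSpace.exp ((-(q / 2 * n)) • w) := by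
    have e : NormedSpace.exp (c • w) ^ 3 * NormedSpace.exp ((-(q / 2 * n)) • w) = 1 := by
      rw [← exp_natCast_smul, ← exp_add', smul_smul, ← add_smul, hc]
      rw [show ((3 : ℕ) : ℝ) * (q / 6 * n) + -(q / 2 * n) = 0 by push_cast; ring, zero_smul,
        NormedSpace.exp_zero]
    rw [mul_pow, mul_assoc, e, mul_one]
  have hterm : ∀ i ∈ range n, ‖NormedSpace.exp ((-(q / 2 * n)) • w)
      * ((1 + w) ^ i * NormedSpace.exp V ^ (n - 1 - i))‖ ≤ 20 / √q * Real.exp 1 := by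
    intro i hi
    obtain ⟨k, hk⟩ : ∃ k, n - 1 - i = k := ⟨_, rfl⟩
    have hnk : (n : ℝ) = i + k + 1 := by
      have := mem_range.mp hi
      have : n = i + k + 1 := by omega
      exact_mod_cast this
    -- The powers satisfy `i + k = n - 1`, so one factor `exp(-(q / 2) w)` is left over; its norm is
    -- at most `e` because `‖w‖ ≤ 2`.
    have e : NormedSpace.exp ((-(q / 2 * n)) • w) * ((1 + w) ^ i * NormedSpace.exp V ^ k)
        = ((1 + w) ^ i * NormedSpace.exp ((k : ℝ) • V - (q / 2 * (i + k)) • w))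
          * NormedSpace.exp ((-(q / 2)) • w) := by
      rw [← exp_natCast_smul]
      have : NormedSpace.exp ((-(q / 2 * n)) • w) * NormedSpace.exp ((k : ℝ) • V)
          = NormedSpace.exp ((k : ℝ) • V - (q / 2 * (i + k)) • w)
            * NormedSpace.exp ((-(q / 2)) • w) := by
        rw [← exp_add', ← exp_add']
        congr 1
        rw [hnk]
        module
      linear_combination (1 + w) ^ i * this
    rw [hk, e]
    refine (norm_mul_le _ _).trans ?_
    gcongr
    · exact norm_binomial_mul_exp_le hq hG hwG i k
    · refine (norm_exp_le _).trans (Real.exp_le_exp.mpr ?_)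
      rw [norm_smul, norm_neg, Real.norm_eq_abs, abs_of_pos (by positivity)]
      nlinarith [norm_nonneg w]
  have hsumle : ‖∑ i ∈ range n, NormedSpace.exp ((-(q / 2 * n)) • w)
      * ((1 + w) ^ i * NormedSpace.exp V ^ (n - 1 - i))‖ ≤ n * (20 / √q * Real.exp 1) := by
    refine (norm_sum_le _ _).trans ((sum_le_sum hterm).trans ?_)
    simp
  have hfac : (1 + w) ^ n - NormedSpace.exp ((n : ℝ) • V)
      = (w * NormedSpace.exp (c • w)) ^ 3 * (r * ∑ i ∈ range n,
        NormedSpace.exp ((-(q / 2 * n)) • w)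
          * ((1 + w) ^ i * NormedSpace.exp V ^ (n - 1 - i))) := by
    rw [exp_natCast_smul, ← geom_sum₂_mul, hr, hcube, ← mul_sum]
    ring
  have hS0 : 0 ≤ S := sum_nonneg fun m _ => Real.sqrt_nonneg _
  rw [hfac]
  calc _ ≤ (54 * S / (q * n)) ^ 3 * ((1 + 8 * Real.exp 4) * (n * (20 / √q * Real.exp 1))) := by
        refine (norm_mul_le _ _).trans ?_
        refine mul_le_mul ((norm_pow_le _ 3).trans (by gcongr)) ?_ (norm_nonneg _) (by positivity)
        refine (norm_mul_le _ _).trans ?_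
        exact mul_le_mul hr' hsumle (norm_nonneg _) (by positivity)
    _ = _ := by
        rw [hippConst]
        have : 0 < √q := Real.sqrt_pos.mpr hq0
        field_simp

end BanachAlgebra

end SignedCP

namespace SignedCP

/-! ### The commutative Banach algebra generated by translations of bounded functions. -/

section TranslationAlgebra

open scoped ENNReal

variable (E : Type)

/-- Bounded functions on `E`. -/
def BddFun : Type := lp (fun _ : E => ℝ) ∞

noncomputable instance : NormedAddCommGroup (BddFun E) :=
  inferInstanceAs (NormedAddCommGroup (lp (fun _ : E => ℝ) ∞))

noncomputable instance : NormedSpace ℝ (BddFun E) :=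
  inferInstanceAs (NormedSpace ℝ (lp (fun _ : E => ℝ) ∞))

instance : CompleteSpace (BddFun E) :=
  inferInstanceAs (CompleteSpace (lp (fun _ : E => ℝ) ∞))

variable {E}

namespace BddFun

/-- The value of a bounded function at a point. -/
def eval (g : BddFun E) (x : E) : ℝ := (show lp (fun _ : E => ℝ) ∞ from g) x

theorem abs_eval_le (g : BddFun E) (x : E) : |g.eval x| ≤ ‖g‖ :=
  lp.norm_apply_le_norm ENNReal.top_ne_zero (show lp (fun _ : E => ℝ) ∞ from g) x

theorem norm_le {g : BddFun E} {C : ℝ} (hC : 0 ≤ C) (h : ∀ x, |g.eval x| ≤ C) : ‖g‖ ≤ C :=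
  lp.norm_le_of_forall_le (f := (show lp (fun _ : E => ℝ) ∞ from g)) hC h

theorem ext {g h : BddFun E} (H : ∀ x, g.eval x = h.eval x) : g = h :=
  Subtype.ext (funext H)

/-- A bounded function from its values. -/
def mk (f : E → ℝ) (C : ℝ) (hf : ∀ x, |f x| ≤ C) : BddFun E :=
  (⟨f, memℓp_infty ⟨C, by
    rintro _ ⟨x, rfl⟩
    exact hf x⟩⟩ : lp (fun _ : E => ℝ) ∞)

/-- The indicator function of a set as a bounded function. -/
noncomputable def indicator (B : Set E) : BddFun E :=
  mk (B.indicator 1) 1 fun x => by by_cases h : x ∈ B <;> simp [h]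

theorem norm_indicator_le (B : Set E) : ‖indicator B‖ ≤ 1 := by
  refine norm_le zero_le_one fun x => ?_
  change |B.indicator (1 : E → ℝ) x| ≤ 1
  by_cases h : x ∈ B <;> simp [h]

/-- Needed for the identity operator to have norm 1. -/
instance [Nonempty E] : Nontrivial (BddFun E) := by
  refine ⟨⟨indicator Set.univ, 0, fun h => ?_⟩⟩
  obtain ⟨x⟩ := ‹Nonempty E›
  have h0 : (indicator Set.univ).eval x = (0 : BddFun E).eval x := by rw [h]
  have h1 : (indicator Set.univ).eval x = 1 := Set.indicator_of_mem (Set.mem_univ _) _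
  rw [h1] at h0
  exact one_ne_zero h0

end BddFun

variable [AddCommMonoid E]

/-- Translation of bounded functions. -/
noncomputable def translation (x : E) : BddFun E →L[ℝ] BddFun E :=
  LinearMap.mkContinuous
    { toFun := fun g => BddFun.mk (fun z => g.eval (z + x)) ‖g‖ fun z => g.abs_eval_le _
      map_add' := fun g h => rfl
      map_smul' := fun r g => rfl } 1 fun g => by
    rw [one_mul]
    exact BddFun.norm_le (norm_nonneg _) fun z => g.abs_eval_le _

theorem norm_translation_le (x : E) : ‖translation x‖ ≤ 1 :=
  LinearMap.mkContinuous_norm_le _ zero_le_one _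

theorem translation_zero : translation (0 : E) = 1 := by
  refine ContinuousLinearMap.ext fun g => BddFun.ext fun z => ?_
  change g.eval (z + 0) = g.eval z
  rw [add_zero]

theorem translation_add (x y : E) : translation (x + y) = translation x * translation y := by
  refine ContinuousLinearMap.ext fun g => BddFun.ext fun z => ?_
  change g.eval (z + (x + y)) = g.eval (z + x + y)
  rw [add_assoc]

variable (E)

/-- The commutative Banach algebra generated by the translations: their double centralizer. -/
noncomputable def translationSubalgebra : Subalgebra ℝ (BddFun E →L[ℝ] BddFun E) :=
  Subalgebra.centralizer ℝ (Set.centralizer (Set.range translation))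

/-- The carrier of `translationSubalgebra`. -/
def TranslationAlgebra : Type := translationSubalgebra E

theorem range_translation_subset_centralizer :
    Set.range (translation (E := E)) ⊆ Set.centralizer (Set.range translation) := by
  rintro _ ⟨x, rfl⟩ _ ⟨y, rfl⟩
  rw [← translation_add, ← translation_add, add_comm]

/-- Translations commute, so they lie in their own centralizer, and the double centralizer is
therefore contained in the centralizer. -/
theorem translationSubalgebra_mul_comm (a b : translationSubalgebra E) : a * b = b * a := by
  refine Subtype.ext ?_
  have hb : (b : BddFun E →L[ℝ] BddFun E) ∈ Set.centralizer (Set.range (translation (E := E))) :=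
    Set.centralizer_subset (range_translation_subset_centralizer E) b.2
  exact (a.2 _ hb).symm

noncomputable instance : NormedCommRing (TranslationAlgebra E) where
  __ := (inferInstance : NormedRing (translationSubalgebra E))
  mul_comm := translationSubalgebra_mul_comm E

noncomputable instance : Algebra ℝ (TranslationAlgebra E) :=
  inferInstanceAs (Algebra ℝ (translationSubalgebra E))

/-- The operator given by an element of the translation algebra. -/
def TranslationAlgebra.op (T : TranslationAlgebra E) : BddFun E →L[ℝ] BddFun E :=
  (show translationSubalgebra E from T).1

noncomputable instance : NormedAlgebra ℝ (TranslationAlgebra E) where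
  norm_smul_le r a := _root_.norm_smul_le r (TranslationAlgebra.op E a)

instance : CompleteSpace (TranslationAlgebra E) := by
  have h : IsClosed (translationSubalgebra E : Set (BddFun E →L[ℝ] BddFun E)) :=
    Set.isClosed_centralizer _
  exact h.completeSpace_coe

instance : NormOneClass (TranslationAlgebra E) where
  norm_one := ContinuousLinearMap.norm_id (𝕜 := ℝ) (E := BddFun E)

variable {E}

/-- Translations as elements of the algebra they generate. -/
noncomputable def shift (x : E) : TranslationAlgebra E :=
  (⟨translation x, Set.subset_centralizer_centralizer ⟨x, rfl⟩⟩ : translationSubalgebra E)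

theorem isContractiveHom_shift : IsContractiveHom (shift (E := E)) where
  map_zero := Subtype.ext translation_zero
  map_add x y := Subtype.ext (translation_add x y)
  norm_le := norm_translation_le

/-- The mass that an element of the translation algebra gives to a set. -/
noncomputable def massLinear (B : Set E) : TranslationAlgebra E →ₗ[ℝ] ℝ where
  toFun T := (T.op E (BddFun.indicator B)).eval 0
  map_add' _ _ := rfl
  map_smul' _ _ := rfl

theorem abs_massLinear_le (B : Set E) (T : TranslationAlgebra E) : |massLinear B T| ≤ ‖T‖ := by
  have h1 := (T.op E (BddFun.indicator B)).abs_eval_le 0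
  have h2 := (T.op E).le_opNorm (BddFun.indicator B)
  refine h1.trans (h2.trans ?_)
  exact mul_le_of_le_one_right (norm_nonneg _) (BddFun.norm_indicator_le B)

/-- `massLinear` as a continuous functional. -/
noncomputable def mass (B : Set E) : TranslationAlgebra E →L[ℝ] ℝ :=
  (massLinear B).mkContinuous 1 fun T => by
    rw [one_mul]
    exact abs_massLinear_le B T

theorem abs_mass_le (B : Set E) (T : TranslationAlgebra E) : |mass B T| ≤ ‖T‖ :=
  abs_massLinear_le B T

theorem mass_shift (B : Set E) (x : E) : mass B (shift x) = B.indicator 1 x := by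
  change B.indicator (1 : E → ℝ) (0 + x) = _
  rw [zero_add]

end TranslationAlgebra

/-! ### The dictionary between discrete signed measures and the translation algebra. -/

section AtomicMeasures

/-- The signed measure `∑ c_i δ_{x_i}`. -/
noncomputable def atomicMeasure {X ι : Type*} [MeasurableSpace X] (c : ι → ℝ) (hc : Summable c)
    (x : ι → X) : SignedMeasure X where
  measureOf' B := open scoped Classical in
    if MeasurableSet B then ∑' i, c i * B.indicator 1 (x i) else 0
  empty' := by simp
  not_measurable' B hB := by simp [hB]
  m_iUnion' f hf hd := by
    simp only [hf, MeasurableSet.iUnion hf, if_true]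
    have hone : ∀ y : X, HasSum (fun n => (f n).indicator (1 : X → ℝ) y)
        ((⋃ n, f n).indicator 1 y) := by
      intro y
      by_cases hy : y ∈ ⋃ n, f n
      · obtain ⟨n, hn⟩ := Set.mem_iUnion.mp hy
        rw [Set.indicator_of_mem hy, Pi.one_apply]
        have := hasSum_single (f := fun n => (f n).indicator (1 : X → ℝ) y) n fun k hk => by
          refine Set.indicator_of_notMem (fun h => ?_) _
          exact Set.disjoint_left.mp (hd hk) h hn
        simpa [hn] using this
      · rw [Set.indicator_of_notMem hy]
        have : ∀ n, (f n).indicator (1 : X → ℝ) y = 0 := fun n =>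
          Set.indicator_of_notMem (fun h => hy (Set.mem_iUnion.mpr ⟨n, h⟩)) _
        simp only [this, hasSum_zero]
    have hnn : ∀ (n : ℕ) (y : X), 0 ≤ (f n).indicator (1 : X → ℝ) y := fun n y =>
      Set.indicator_nonneg (fun _ _ => zero_le_one) y
    have hs : Summable fun z : ι × ℕ => c z.1 * (f z.2).indicator (1 : X → ℝ) (x z.1) := by
      rw [← summable_abs_iff, summable_prod_of_nonneg fun _ => abs_nonneg _]
      simp only [abs_mul, abs_of_nonneg (hnn _ _)]
      refine ⟨fun i => (hone (x i)).summable.mul_left _, ?_⟩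
      refine Summable.of_nonneg_of_le (fun i => tsum_nonneg fun n => by
        exact mul_nonneg (abs_nonneg _) (hnn _ _)) (fun i => ?_) hc.abs
      rw [tsum_mul_left, (hone (x i)).tsum_eq]
      refine mul_le_of_le_one_right (abs_nonneg _) ?_
      exact Set.indicator_le_self' (fun _ _ => zero_le_one) _
    have h1 := hs.hasSum.prod_fiberwise fun i => (hone (x i)).mul_left (c i)
    have hs' := (Equiv.prodComm ℕ ι).summable_iff.mpr hs
    have h2 := ((Equiv.prodComm ℕ ι).hasSum_iff.mpr hs.hasSum).prod_fiberwise
      fun n => (hs'.prod_factor n).hasSum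
    rw [h1.tsum_eq]
    exact h2

theorem hasSum_atomicMeasure {X ι : Type*} [MeasurableSpace X] {c : ι → ℝ} (hc : Summable c)
    (x : ι → X) {B : Set X} (hB : MeasurableSet B) :
    HasSum (fun i => c i * B.indicator 1 (x i)) (atomicMeasure c hc x B) := by
  have e : atomicMeasure c hc x B = ∑' i, c i * B.indicator 1 (x i) := if_pos hB
  rw [e]
  refine (Summable.of_norm_bounded hc.abs fun i => ?_).hasSum
  rw [norm_mul, Real.norm_eq_abs]
  refine mul_le_of_le_one_right (abs_nonneg _) ?_
  by_cases h : x i ∈ B <;> simp [h]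

variable {E : Type} [AddCommMonoid E] [MeasurableSpace E]

/-- The discrete signed measure `M` and the element `T` of the translation algebra are given by the
same series of atoms. -/
def Represents (M : SignedMeasure E) (T : TranslationAlgebra E) : Prop :=
  ∃ (ι : Type) (c : ι → ℝ) (x : ι → E), Summable c ∧
    (∀ B, MeasurableSet B → HasSum (fun i => c i * B.indicator 1 (x i)) (M B)) ∧
    HasSum (fun i => c i • shift (x i)) T

namespace Represents

variable {M V : SignedMeasure E} {T S : TranslationAlgebra E}

/-- A continuous functional passes through the series of `T`, and on a translation it gives the
value of a point mass. -/
theorem apply_eq (h : Represents M T) {B : Set E} (hB : MeasurableSet B) : M B = mass B T := by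
  obtain ⟨ι, c, x, hc, hM, hT⟩ := h
  refine (hM B hB).unique ?_
  simpa [mass_shift] using hT.mapL (mass B)

theorem unitMass : Represents (SignedCP.unitMass E) 1 := by
  refine ⟨Unit, 1, 0, (hasSum_unique _).summable, fun B hB => ?_, ?_⟩
  · have := hasSum_unique (fun i : Unit => (1 : Unit → ℝ) i * B.indicator 1 ((0 : Unit → E) i))
    convert this using 1
    rw [SignedCP.unitMass, Measure.toSignedMeasure_apply_measurable hB, measureReal_def,
      Measure.dirac_apply' _ hB]
    by_cases h : (0 : E) ∈ B <;> simp [h]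
  · have := hasSum_unique (fun i : Unit => (1 : Unit → ℝ) i • shift ((0 : Unit → E) i))
    rwa [Pi.one_apply, one_smul, Pi.zero_apply, isContractiveHom_shift.map_zero] at this

theorem smul (r : ℝ) (h : Represents M T) : Represents (r • M) (r • T) := by
  obtain ⟨ι, c, x, hc, hM, hT⟩ := h
  refine ⟨ι, fun i => r * c i, x, hc.mul_left r, fun B hB => ?_, ?_⟩
  · simpa [mul_assoc] using (hM B hB).mul_left r
  · simpa [mul_smul] using hT.const_smul r

theorem add (h : Represents M T) (h' : Represents V S) : Represents (M + V) (T + S) := by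
  obtain ⟨ι, c, x, hc, hM, hT⟩ := h
  obtain ⟨ι', c', x', hc', hM', hT'⟩ := h'
  refine ⟨ι ⊕ ι', Sum.elim c c', Sum.elim x x', ?_, fun B hB => ?_, ?_⟩
  · exact (HasSum.sum (f := Sum.elim c c') hc.hasSum hc'.hasSum).summable
  · exact HasSum.sum (f := fun i => Sum.elim c c' i * B.indicator 1 (Sum.elim x x' i))
      (hM B hB) (hM' B hB)
  · exact HasSum.sum (f := fun i => Sum.elim c c' i • shift (Sum.elim x x' i)) hT hT'

theorem sub (h : Represents M T) (h' : Represents V S) : Represents (M - V) (T - S) := by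
  have e : M - V = M + (-1 : ℝ) • V := by
    ext B _
    simp [sub_eq_add_neg]
  have := h.add (h'.smul (-1))
  rwa [← e, neg_one_smul, ← sub_eq_add_neg] at this

theorem sum {κ : Type*} (s : Finset κ) {M : κ → SignedMeasure E} {T : κ → TranslationAlgebra E}
    (h : ∀ m, Represents (M m) (T m)) : Represents (∑ m ∈ s, M m) (∑ m ∈ s, T m) := by
  classical
  induction s using Finset.induction_on with
  | empty => simpa using (unitMass (E := E)).smul 0
  | insert m s hm ih =>
    rw [Finset.sum_insert hm, Finset.sum_insert hm]
    exact (h m).add ih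

theorem conv [MeasurableAdd₂ E] (h : Represents M T) (h' : Represents V S) :
    Represents (SignedCP.conv M V) (T * S) := by
  obtain ⟨ι, c, x, hc, hM, hT⟩ := h
  obtain ⟨ι', c', x', hc', hM', hT'⟩ := h'
  have hcc : Summable fun z : ι × ι' => c z.1 * c' z.2 :=
    summable_mul_of_summable_norm hc.norm hc'.norm
  -- A signed product measure is determined by its values on rectangles, where the double series
  -- factors.
  have hprod : M.prod V (ContinuousLinearMap.mul ℝ ℝ)
      = atomicMeasure (fun z : ι × ι' => c z.1 * c' z.2) hcc fun z => (x z.1, x' z.2) := by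
    refine VectorMeasure.prod_eq_of_forall_apply_prod fun s t hs ht => ?_
    refine (hasSum_atomicMeasure hcc _ (hs.prod ht)).unique ?_
    have h1 := HasSum.mul (hM s hs) (hM' t ht)
      (summable_mul_of_summable_norm (hM s hs).summable.norm (hM' t ht).summable.norm)
    simp only [ContinuousLinearMap.mul_apply']
    refine Eq.mp (congrArg (HasSum · _) (funext fun z => ?_)) h1
    by_cases h1 : x z.1 ∈ s <;> by_cases h2 : x' z.2 ∈ t <;> simp [h1, h2]
  refine ⟨ι × ι', fun z => c z.1 * c' z.2, fun z => x z.1 + x' z.2, hcc, fun B hB => ?_, ?_⟩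
  · have hm : Measurable fun z : E × E => z.1 + z.2 := measurable_add
    rw [SignedCP.conv, VectorMeasure.map_apply _ hm hB, hprod]
    exact hasSum_atomicMeasure hcc _ (hm hB)
  · have hv := isContractiveHom_shift (E := E)
    have hb : ∀ (κ : Type) (a : κ → ℝ) (y : κ → E), Summable a →
        Summable fun i => ‖a i • shift (y i)‖ := fun κ a y ha =>
      Summable.of_nonneg_of_le (fun _ => norm_nonneg _) (fun i => by
        rw [norm_smul, Real.norm_eq_abs]
        exact mul_le_of_le_one_right (abs_nonneg _) (hv.norm_le _)) ha.abs
    have h1 := HasSum.mul (f := fun i => c i • shift (x i)) (g := fun i => c' i • shift (x' i))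
      hT hT' (summable_mul_of_summable_norm (f := fun i => c i • shift (x i))
        (g := fun i => c' i • shift (x' i)) (hb ι c x hc) (hb ι' c' x' hc'))
    refine Eq.mp (congrArg (HasSum · _) (funext fun z => ?_)) h1
    rw [smul_mul_smul_comm, hv.map_add]

theorem convPow [MeasurableAdd₂ E] (h : Represents M T) (j : ℕ) :
    Represents (SignedCP.convPow M j) (T ^ j) := by
  induction j with
  | zero => exact pow_zero T ▸ unitMass
  | succ j ih =>
    rw [pow_succ]
    exact ih.conv h

/-- The setwise series of `expMeasure` is the image under `mass B` of the norm-convergent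
exponential series, term by term. -/
theorem expMeasure_apply [MeasurableAdd₂ E] (h : Represents M T) {B : Set E}
    (hB : MeasurableSet B) : expMeasure M B = mass B (NormedSpace.exp T) := by
  refine (hasSum_expMeasure M hB).unique ?_
  have := (hasSum_exp T).mapL (mass B)
  simpa [fun j => (h.convPow j).apply_eq hB] using this

end Represents

end AtomicMeasures

end SignedCP

namespace SignedCP

/-! ### Mixtures of laws on lines and the final estimate. -/

section Lines

variable {d : ℕ}

/-- A law carried by the integer multiples of a vector is the sum of its atoms. -/
theorem hasSum_atoms (μ : Measure (EuclideanSpace ℝ (Fin d))) [IsFiniteMeasure μ]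
    {y : EuclideanSpace ℝ (Fin d)} (hy : y ≠ 0)
    (hsupp : μ.support ⊆ {x | ∃ k : ℤ, k ≠ 0 ∧ x = (k : ℝ) • y})
    {B : Set (EuclideanSpace ℝ (Fin d))} (hB : MeasurableSet B) :
    HasSum (fun k : ℤ => μ.real {(k : ℝ) • y} * B.indicator 1 ((k : ℝ) • y)) (μ.real B) := by
  have hinj : Function.Injective fun k : ℤ => (k : ℝ) • y := fun k l h => by
    have := smul_left_injective ℝ hy h
    exact_mod_cast this
  have hm : ∀ k : ℤ, MeasurableSet (B ∩ {(k : ℝ) • y}) := fun k =>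
    hB.inter (measurableSet_singleton _)
  have hd : Pairwise (Function.onFun Disjoint fun k : ℤ => B ∩ {(k : ℝ) • y}) := by
    intro k l hkl
    refine Set.disjoint_left.mpr fun x hx hx' => hkl (hinj ?_)
    exact (Set.mem_singleton_iff.mp hx.2).symm.trans (Set.mem_singleton_iff.mp hx'.2)
  have h1 := VectorMeasure.hasSum_of_disjoint_iUnion (v := μ.toSignedMeasure) hm hd
  have h2 : μ.real (⋃ k : ℤ, B ∩ {(k : ℝ) • y}) = μ.real B := by
    refine measureReal_congr ?_
    have h0 : μ (⋃ k : ℤ, {(k : ℝ) • y})ᶜ = 0 := by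
      refine measure_mono_null (Set.compl_subset_compl.mpr ?_) μ.measure_compl_support
      intro x hx
      obtain ⟨k, -, rfl⟩ := hsupp hx
      exact Set.mem_iUnion.mpr ⟨k, rfl⟩
    have h3 : ∀ᵐ x ∂μ, x ∈ ⋃ k : ℤ, {(k : ℝ) • y} := h0
    filter_upwards [h3] with x hx
    refine propext ?_
    change x ∈ ⋃ k : ℤ, B ∩ {(k : ℝ) • y} ↔ x ∈ B
    rw [← Set.inter_iUnion]
    exact ⟨fun h => h.1, fun h => ⟨h, hx⟩⟩
  rw [Measure.toSignedMeasure_apply_measurable (MeasurableSet.iUnion hm), h2] at h1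
  refine Eq.mp (congrArg (HasSum · _) (funext fun k => ?_)) h1
  rw [Measure.toSignedMeasure_apply_measurable (hm k)]
  by_cases h : (k : ℝ) • y ∈ B
  · rw [Set.inter_eq_self_of_subset_right (Set.singleton_subset_iff.mpr h)]
    simp [h]
  · rw [(Set.disjoint_singleton_right.mpr h).inter_eq]
    simp [h]

variable {K : ℕ} {F : Measure (EuclideanSpace ℝ (Fin d))} {q : ℝ} {p : Fin K → ℝ}
  {G : Fin K → Measure (EuclideanSpace ℝ (Fin d))} {y : Fin K → EuclideanSpace ℝ (Fin d)}

namespace LinesAssumptions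

theorem isSymmetricLaw (h : LinesAssumptions F q p G y) (m : Fin K)
    (hs : Summable (secondMomentTerm (G m) (y m))) :
    IsSymmetricLaw (fun k : ℤ => (G m).real {(k : ℝ) • y m}) (sigma (G m) (y m)) where
  nonneg k := measureReal_nonneg
  zero := by
    have h0 : (0 : EuclideanSpace ℝ (Fin d)) ∉ (G m).support := by
      intro h0
      obtain ⟨k, hk, hk'⟩ := h.support_subset m h0
      rcases smul_eq_zero.mp hk'.symm with h1 | h1
      · exact hk (by exact_mod_cast h1)
      · exact h.y_ne_zero m h1
    have h1 : G m {0} = 0 :=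
      measure_mono_null (Set.singleton_subset_iff.mpr h0) (G m).measure_compl_support
    simp [measureReal_def, h1]
  symm := by
    have hpos : ∀ k : ℕ, (G m).real {((-(k : ℤ) : ℤ) : ℝ) • y m}
        = (G m).real {(((k : ℤ) : ℝ)) • y m} := by
      intro k
      rcases Nat.eq_zero_or_pos k with rfl | hk
      · simp
      · have := h.symmetric m k hk
        simp only [measureReal_def]
        push_cast
        rw [neg_smul, this]
    intro k
    obtain ⟨n, rfl | rfl⟩ := k.eq_nat_or_neg
    · exact hpos n
    · rw [neg_neg]
      exact (hpos n).symm
  hasSum := by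
    have := h.isProbabilityMeasure m
    have h1 := hasSum_atoms (G m) (h.y_ne_zero m) (h.support_subset m) MeasurableSet.univ
    simpa using h1
  hasSum_sq := by
    have h0 : 0 ≤ ∑' k : ℤ, secondMomentTerm (G m) (y m) k := tsum_nonneg fun k =>
      mul_nonneg (sq_nonneg _) measureReal_nonneg
    rw [sigma, Real.sq_sqrt h0]
    exact hs.hasSum

theorem toSignedMeasure_eq [IsProbabilityMeasure F] [∀ m, IsProbabilityMeasure (G m)]
    (h : LinesAssumptions F q p G y) :
    F.toSignedMeasure = q • unitMass (EuclideanSpace ℝ (Fin d))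
      + ∑ m, p m • (G m).toSignedMeasure := by
  refine VectorMeasure.ext fun B hB => ?_
  have hF : F B = ENNReal.ofReal q * Measure.dirac 0 B + ∑ m, ENNReal.ofReal (p m) * G m B := by
    rw [h.mixture]
    simp [Finset.sum_apply]
  have hsum : ∀ s : Finset (Fin K), (∑ m ∈ s, p m • (G m).toSignedMeasure) B
      = ∑ m ∈ s, p m * (G m).real B := by
    intro s
    classical
    induction s using Finset.induction_on with
    | empty => simp
    | insert m s hm ih =>
      rw [Finset.sum_insert hm, Finset.sum_insert hm, _root_.add_apply, ih,
        _root_.smul_apply, Measure.toSignedMeasure_apply_measurable hB, smul_eq_mul]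
  rw [_root_.add_apply, hsum, _root_.smul_apply, unitMass,
    Measure.toSignedMeasure_apply_measurable hB, Measure.toSignedMeasure_apply_measurable hB,
    smul_eq_mul, measureReal_def, hF, ENNReal.toReal_add (by finiteness)
      (ENNReal.sum_ne_top.mpr fun m _ => by finiteness),
    ENNReal.toReal_sum (fun m _ => by finiteness)]
  simp only [ENNReal.toReal_mul, ENNReal.toReal_ofReal h.q_mem.1.le,
    ENNReal.toReal_ofReal (h.p_mem _).1.le, measureReal_def]

/-- Both measures evaluate on `B` through `mass B`, whose norm is at most 1 for every `B`, so one
norm estimate in the translation algebra bounds the whole supremum. -/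
theorem tvDist_le [IsProbabilityMeasure F] (h : LinesAssumptions F q p G y)
    (hs : ∀ m, Summable (secondMomentTerm (G m) (y m))) {n : ℕ} (hn : 1 ≤ n) :
    tvDist (convPow F.toSignedMeasure n) (hippD F n) ≤
      hippConst * (∑ m, √(1 + sigma (G m) (y m))) ^ 3 / ((n : ℝ) ^ 2 * (q ^ 3 * √q)) := by
  have := h.isProbabilityMeasure
  have hP := fun m => h.isSymmetricLaw m (hs m)
  have hv : ∀ m, IsContractiveHom fun k : ℤ => shift ((k : ℝ) • y m) := fun m =>
    { map_zero := by simp [isContractiveHom_shift.map_zero]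
      map_add := fun i j => by
        rw [Int.cast_add, add_smul, isContractiveHom_shift.map_add]
      norm_le := fun i => isContractiveHom_shift.norm_le _ }
  have hex : ∀ m, ∃ X, HasSum (fun k : ℤ => (G m).real {(k : ℝ) • y m} • shift ((k : ℝ) • y m)) X :=
    fun m => ⟨_, ((hv m).summable_norm_smul (hP m).hasSum.summable).of_norm.hasSum⟩
  choose X hX using hex
  have hG : ∀ m, Represents (G m).toSignedMeasure (X m) := fun m =>
    ⟨ℤ, _, _, (hP m).hasSum.summable, fun B hB => by
      rw [Measure.toSignedMeasure_apply_measurable hB]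
      exact hasSum_atoms (G m) (h.y_ne_zero m) (h.support_subset m) hB, hX m⟩
  obtain ⟨w, hw⟩ : ∃ w, w = ∑ m, p m • (X m - 1) := ⟨_, rfl⟩
  have hF : Represents F.toSignedMeasure (1 + w) := by
    have e : 1 + w = q • 1 + ∑ m, p m • X m := by
      rw [hw, sum_smul_sub_one, h.sum_p]
      module
    rw [e, h.toSignedMeasure_eq]
    exact (Represents.unitMass.smul q).add (Represents.sum _ fun m => (hG m).smul (p m))
  have hΔ : Represents (F.toSignedMeasure - unitMass _) w := by
    have := hF.sub Represents.unitMass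
    rwa [add_sub_cancel_left] at this
  have hD := (hΔ.smul (n : ℝ)).sub ((hΔ.convPow 2).smul ((n : ℝ) / 2))
  have e2 : (n : ℝ) • w - ((n : ℝ) / 2) • w ^ 2 = (n : ℝ) • (w - (1 / 2 : ℝ) • w ^ 2) := by
    module
  rw [e2] at hD
  have hmain := norm_pow_sub_exp_le hn h.q_mem (fun m => (h.p_mem m).1) h.sum_p
    (fun m => Real.sqrt_nonneg _) hP hv hX hw
  refine ciSup_le fun B => ?_
  rw [(hF.convPow n).apply_eq B.2, hippD, hD.expMeasure_apply B.2, ← map_sub]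
  exact (abs_mass_le _ _).trans hmain

end LinesAssumptions

theorem hippConst_pos : 0 < hippConst := by
  unfold hippConst
  positivity

end Lines

end SignedCP

theorem theorem9 :
    ∃ C : ℝ, 0 < C ∧
      ∀ (d K : ℕ) (F : Measure (EuclideanSpace ℝ (Fin d))) [IsProbabilityMeasure F] (q : ℝ)
        (p : Fin K → ℝ) (G : Fin K → Measure (EuclideanSpace ℝ (Fin d)))
        (y : Fin K → EuclideanSpace ℝ (Fin d)),
        SignedCP.LinesAssumptions F q p G y →
        (∀ m, Summable (SignedCP.secondMomentTerm (G m) (y m))) →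
        ∀ n : ℕ, 1 ≤ n →
          SignedCP.tvDist (SignedCP.convPow F.toSignedMeasure n) (SignedCP.hippD F n)
            ≤ C / ((n : ℝ) ^ 2 * q ^ (13 / 2 : ℝ))
                * (∑ m, √(1 + SignedCP.sigma (G m) (y m))) ^ 3 := by
  refine ⟨SignedCP.hippConst, SignedCP.hippConst_pos, ?_⟩
  intro d K F _ q p G y h hs n hn
  refine (h.tvDist_le hs hn).trans ?_
  obtain ⟨hq0, hq1⟩ := h.q_mem
  have hn0 : (0 : ℝ) < n := by exact_mod_cast hn
  -- The bound obtained has `q^(7/2)` in the denominator; for `q < 1` it is stronger than the one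
  -- required.
  have hpow : q ^ (13 / 2 : ℝ) ≤ q ^ 3 * √q := by
    rw [Real.sqrt_eq_rpow, ← Real.rpow_natCast, ← Real.rpow_add hq0]
    exact Real.rpow_le_rpow_of_exponent_ge hq0 hq1.le (by norm_num)
  have hq2 : 0 < q ^ (13 / 2 : ℝ) := Real.rpow_pos_of_pos hq0 _
  have hS : 0 ≤ ∑ m, √(1 + SignedCP.sigma (G m) (y m)) :=
    Finset.sum_nonneg fun m _ => Real.sqrt_nonneg _
  have hC := SignedCP.hippConst_pos
  rw [div_mul_eq_mul_div]
  gcongr
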